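/- **Setting.** There are $N$ users and one time zone with slots $h=1,\dots,H$. The preference vector $g=(g_1,\dots,g_N)$ is jointly Gaussian, drawn once for the whole time zone, with mean $\bar g\mathbf 1$, $\bar g>0$, and covariance matrix $\Sigma=(\sigma_{ij})$, $\sigma_{ii}>0$. In slot $h$ let $\gamma_h,\kappa_h,\alpha_h>0$, and let the renewable term $\omega_h$ be an integrable random variable with mean $\bar\omega_h$, independent of $g$. At a consumption profile $l=(l_1,\dots,l_N)$ with total $L=\sum_i l_i$ the unit price is $p_h=\frac{\gamma_h}{N}(L+\omega_h)$, user $i$'s utility is $u_{i,h}=-l_ip_h+g_il_i-\alpha_hl_i^2$, the aggregate utility is $U_h=\sum_iu_{i,h}$, and the welfare is $W_h=U_h+p_hL-\frac{\kappa_h}{N}L^2$. For $\Gamma={\rm S},{\rm U},{\rm W}$ the payoff $u^\Gamma_{i,h}$ of user $i$ is $u_{i,h}$, $U_h$, $W_h$, respectively. The information $I_{i,h}$ of user $i$ at slot $h$ is: $g_i$ alone ($\Omega={\rm P}$); $g_i$ and the consumption in slots $1,\dots,h-1$ of all $j$ with an edge $(j,i)$ in a fixed communication graph ($\Omega={\rm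 AS}$); $g_i$ and the total consumption in slots $1,\dots,h-1$ ($\Omega={\rm B}$). A strategy profile consists of measurable real-valued functions $s_{i,h}$ of $I_{i,h}$ whose realized consumptions $l_{i,h}=s_{i,h}(I_{i,h})$ have finite second moments. It is a Bayesian Nash equilibrium (BNE) if for all $i,h$ and every measurable deviation $s'_{i,h}$ with finite second moment, almost surely $$E\big[u^\Gamma_{i,h}(s_{i,h},s_{-i,h})\,\big|\,I_{i,h}\big]\ \ge\ E\big[u^\Gamma_{i,h}(s'_{i,h},s_{-i,h})\,\big|\,I_{i,h}\big].$$ Put $\lambda_h=\mu_h=\tau_h=\gamma_h/N$ if $\Gamma={\rm S}$; $\lambda_h=2\gamma_h/N$, $\mu_h=\tau_h=\gamma_h/N$ if $\Gamma={\rm U}$; $\lambda_h=2\kappa_h/N$, $\mu_h=0$, $\tau_h=\kappa_h/N$ if $\Gamma={\rm W}$; and $\rho_h=(2(\tau_h+\alpha_h))^{-1}$. Let $\tilde g=(g^T,\bar g)^T\in\mathbb R^{N+1}$ and let $e_i$ be the $i$-th unit vector of $\mathbb R^{N+1}$. **Filter.** A run of the filter consists of matrices $T_{i,h},M_{i,h}\in\mathbb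 R^{(N+1)\times(N+1)}$, gains $K_{i,h}$, vectors $v_{i,h}\in\mathbb R^{N+1}$ and numbers $r_{i,h}$ such that, for all $i$ and $h$: * $T_{i,1}$ is the matrix with $(T_{i,1}\tilde g)_j=\frac{\sigma_{ij}}{\sigma_{ii}}g_i+\big(1-\frac{\sigma_{ij}}{\sigma_{ii}}\big)\bar g$ for $j\le N$ and $(T_{i,1}\tilde g)_{N+1}=\bar g$ (as linear forms in $\tilde g$), and $M_{i,1}$ has entries $\sigma_{jk}-\sigma_{ij}\sigma_{ik}/\sigma_{ii}$ for $j,k\le N$ and zeros in the last row and column; * $(v_{i,h},r_{i,h})_{i}$ solve $$T_{i,h}^Tv_{i,h}+\rho_h\lambda_h\sum_{j\ne i}T_{i,h}^TT_{j,h}^Tv_{j,h}=\rho_he_i,\qquad r_{i,h}+\rho_h\lambda_h\sum_{j\neq i}r_{j,h}=-\rho_h\mu_h\bar\omega_h;$$ * the observation matrix $H_{i,h}$ has no columns ($\Omega={\rm P}$), has the columns $T_{j,h}^Tv_{j,h}$ for the edges $(j,i)$ ($\Omega={\rm AS}$), or has the single column $\sum_jT_{j,h}^Tv_{j,h}$ ($\Omega={\rm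 B}$); and, with $S^+$ the Moore–Penrose pseudoinverse (the inverse if $S$ is nonsingular), $K_{i,h}=M_{i,h}H_{i,h}\big(H_{i,h}^TM_{i,h}H_{i,h}\big)^{+}$; * $T_{i,h+1}=T_{i,h}+K_{i,h}\big(H_{i,h}^T-H_{i,h}^TT_{i,h}\big)$ and $M_{i,h+1}=M_{i,h}-K_{i,h}H_{i,h}^TM_{i,h}$ for $h<H$. **Proposition 1.** Let $\Gamma\in\{{\rm S},{\rm U},{\rm W}\}$ and $\Omega\in\{{\rm P},{\rm AS},{\rm B}\}$. The repeated Bayesian game has a BNE, and it is unique up to null sets (both as functions of the information and in realized consumption). The filter has a run. For the BNE $s$ and any run of the filter, for all $i$ and $h$, almost surely $$E[\tilde g\mid I_{i,h}]=T_{i,h}\tilde g,\qquad s_{i,h}(I_{i,h})=v_{i,h}^TE[\tilde g\mid I_{i,h}]+r_{i,h},$$ and $M_{i,h}=E\big[(\tilde g-E[\tilde g\mid I_{i,h}])(\tilde g-E[\tilde g\mid I_{i,h}])^T\big]$. -/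

import Mathlib

open MeasureTheory ProbabilityTheory Matrix

noncomputable section

namespace DemandResponse

/-- Consumer behaviour: each user maximises its own utility (`selfish`), the aggregate utility
(`altruistic`) or the welfare (`welfare`). -/
inductive Behavior where
  | selfish
  | altruistic
  | welfare

/-- Information exchange model: `priv` (nothing is exchanged), `share E` (after every slot user `i`
sees the consumption of each `j` with an edge `(j, i)` in the communication network `E`), or
`broadcast` (after every slot everybody sees the total consumption). -/
inductive InfoModel (N : ℕ) where
  | priv
  | share (E : Digraph (Fin N))
  | broadcast

/-- Index set of the numbers that user `i` observes at the end of one slot. -/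
def ObsIndex {N : ℕ} : InfoModel N → Fin N → Type
  | .priv, _ => Empty
  | .share E, i => {j : Fin N // E.Adj j i}
  | .broadcast, _ => Unit

instance {N : ℕ} (m : InfoModel N) (i : Fin N) : Fintype (ObsIndex m i) :=
  match m with
  | .priv => inferInstanceAs (Fintype Empty)
  | .share E => by
      classical
      exact inferInstanceAs (Fintype {j : Fin N // E.Adj j i})
  | .broadcast => inferInstanceAs (Fintype Unit)

/-- What user `i` observes at the end of a slot in which the consumption profile was `l`. -/
def observe {N : ℕ} : (m : InfoModel N) → (i : Fin N) → (Fin N → ℝ) → ObsIndex m i → ℝ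
  | .priv, _, _ => fun o => nomatch (o : Empty)
  | .share _, _, l => fun o => l o.1
  | .broadcast, _, l => fun _ => ∑ j, l j

/-- The data of the repeated game on one time zone with slots `0, …, H - 1`: behaviour and
information model, price parameters `γ_h`, cost parameters `κ_h`, decay parameters `α_h`, mean
`ω̄_h` of the renewable term, common mean `ḡ` and covariance matrix of the preferences. -/
structure EnergyGame (N : ℕ) where
  behavior : Behavior
  info : InfoModel N
  H : ℕ
  gamma : ℕ → ℝ
  kappa : ℕ → ℝ
  alpha : ℕ → ℝ
  omegaBar : ℕ → ℝ
  gBar : ℝ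
  cov : Matrix (Fin N) (Fin N) ℝ

variable {N : ℕ}

/-! ### Payoffs -/

/-- Unit price in slot `h` when the total consumption is `L` and the renewable term is `w`. -/
def price (G : EnergyGame N) (h : ℕ) (L w : ℝ) : ℝ := G.gamma h / N * (L + w)

/-- Individual utility of user `i` at consumption profile `l` and preferences `g`. -/
def utility (G : EnergyGame N) (h : ℕ) (i : Fin N) (l g : Fin N → ℝ) (w : ℝ) : ℝ :=
  -(l i * price G h (∑ j, l j) w) + g i * l i - G.alpha h * l i ^ 2

/-- Aggregate utility of the population. -/
def aggregateUtility (G : EnergyGame N) (h : ℕ) (l g : Fin N → ℝ) (w : ℝ) : ℝ :=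
  ∑ j, utility G h j l g w

/-- Net revenue of the operator: revenue minus the quadratic cost of supply. -/
def netRevenue (G : EnergyGame N) (h : ℕ) (L w : ℝ) : ℝ :=
  price G h L w * L - G.kappa h / N * L ^ 2

/-- Welfare: aggregate utility plus net revenue. -/
def welfareValue (G : EnergyGame N) (h : ℕ) (l g : Fin N → ℝ) (w : ℝ) : ℝ :=
  aggregateUtility G h l g w + netRevenue G h (∑ j, l j) w

/-- The stage payoff that user `i` maximises under the behaviour model of the game. -/
def payoff (G : EnergyGame N) (h : ℕ) (i : Fin N) (l g : Fin N → ℝ) (w : ℝ) : ℝ :=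
  match G.behavior with
  | .selfish => utility G h i l g w
  | .altruistic => aggregateUtility G h l g w
  | .welfare => welfareValue G h l g w

/-! ### Strategies, play and equilibrium -/

/-- Information of user `i` at slot `h`: its own preference and its observations in the slots
`0, …, h - 1`. -/
abbrev Info (G : EnergyGame N) (h : ℕ) (i : Fin N) : Type :=
  ℝ × (Fin h → ObsIndex G.info i → ℝ)

/-- A strategy profile assigns to every slot and user a map from information to consumption. -/
abbrev Profile (G : EnergyGame N) : Type :=
  (h : ℕ) → (i : Fin N) → Info G h i → ℝ

/-- The consumption profile in each slot when the users play `s` and the preferences are `g`. -/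
def play (G : EnergyGame N) (s : Profile G) (g : Fin N → ℝ) : ℕ → Fin N → ℝ
  | h => fun i => s h i (g i, fun t : Fin h => observe G.info i (play G s g t))
termination_by h => h
decreasing_by exact t.2

/-- The information that user `i` holds at slot `h` when the users play `s`. -/
def infoAt (G : EnergyGame N) (s : Profile G) (g : Fin N → ℝ) (h : ℕ) (i : Fin N) : Info G h i :=
  (g i, fun t : Fin h => observe G.info i (play G s g t))

variable {Ω : Type*} [MeasurableSpace Ω]

/-- The σ-algebra generated by the information of user `i` at slot `h`. -/
abbrev infoSigma (G : EnergyGame N) (s : Profile G) (g : Ω → Fin N → ℝ) (h : ℕ) (i : Fin N) :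
    MeasurableSpace Ω :=
  MeasurableSpace.comap (fun x => infoAt G s (g x) h i) inferInstance

/-- Bayesian Nash equilibrium of the repeated game: a profile of measurable strategies with finite
second moments such that, in every slot, no user can raise its conditional expected payoff, given
its information, by switching to another measurable strategy with finite second moment. -/
structure IsBNE (G : EnergyGame N) (P : Measure Ω) (g : Ω → Fin N → ℝ) (ω : ℕ → Ω → ℝ)
    (s : Profile G) : Prop where
  measurable : ∀ h < G.H, ∀ i, Measurable (s h i)
  memLp : ∀ h < G.H, ∀ i, MemLp (fun x => play G s (g x) h i) 2 P
  optimal : ∀ h < G.H, ∀ i, ∀ d : Info G h i → ℝ, Measurable d →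
    MemLp (fun x => d (infoAt G s (g x) h i)) 2 P →
    P[fun x => payoff G h i
        (Function.update (play G s (g x) h) i (d (infoAt G s (g x) h i))) (g x) (ω h x)
      | infoSigma G s g h i]
    ≤ᵐ[P]
    P[fun x => payoff G h i (play G s (g x) h) (g x) (ω h x) | infoSigma G s g h i]

/-! ### Augmented preferences and posterior means -/

/-- Coordinates of the augmented preference vector: one per user, and one for the mean `ḡ`. -/
abbrev Aug (N : ℕ) : Type := Fin N ⊕ Unit

/-- The augmented preference vector `g̃ = (g, ḡ)`. -/
def augment (G : EnergyGame N) (g : Fin N → ℝ) : Aug N → ℝ := Sum.elim g (fun _ => G.gBar)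

/-- The posterior mean of the augmented preference vector given the information of user `i` at
slot `h`. -/
def posteriorMean (G : EnergyGame N) (P : Measure Ω) (g : Ω → Fin N → ℝ) (s : Profile G) (h : ℕ)
    (i : Fin N) (x : Ω) (a : Aug N) : ℝ :=
  (P[fun y => augment G (g y) a | infoSigma G s g h i]) x

/-! ### The coefficients of the best response -/

def lam (G : EnergyGame N) (h : ℕ) : ℝ :=
  match G.behavior with
  | .selfish => G.gamma h / N
  | .altruistic => 2 * G.gamma h / N
  | .welfare => 2 * G.kappa h / N

def mu (G : EnergyGame N) (h : ℕ) : ℝ :=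
  match G.behavior with
  | .selfish => G.gamma h / N
  | .altruistic => G.gamma h / N
  | .welfare => 0

def tau (G : EnergyGame N) (h : ℕ) : ℝ :=
  match G.behavior with
  | .selfish => G.gamma h / N
  | .altruistic => G.gamma h / N
  | .welfare => G.kappa h / N

def rho (G : EnergyGame N) (h : ℕ) : ℝ := (2 * (tau G h + G.alpha h))⁻¹

/-! ### The sequential game filter -/

/-- `B` is the Moore–Penrose pseudoinverse of the real matrix `A`; it is the inverse of `A` when `A`
is square and nonsingular. -/
structure IsMoorePenrose {m n : Type*} [Fintype m] [Fintype n] (A : Matrix m n ℝ)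
    (B : Matrix n m ℝ) : Prop where
  left : A * B * A = A
  right : B * A * B = B
  symm_left : (A * B)ᵀ = A * B
  symm_right : (B * A)ᵀ = B * A

/-- Weights of the prior estimate: `E[g_j | g_i] = (σ_ij / σ_ii) g_i + (1 - σ_ij / σ_ii) ḡ`. -/
def initialWeights (G : EnergyGame N) (i : Fin N) : Matrix (Aug N) (Aug N) ℝ :=
  Matrix.fromBlocks
    (Matrix.of fun j k => if k = i then G.cov i j / G.cov i i else 0)
    (Matrix.of fun j _ => 1 - G.cov i j / G.cov i i)
    0 1

/-- Error covariance of the augmented preferences given `g_i`. -/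
def initialError (G : EnergyGame N) (i : Fin N) : Matrix (Aug N) (Aug N) ℝ :=
  Matrix.fromBlocks
    (Matrix.of fun j k => G.cov j k - G.cov i j * G.cov i k / G.cov i i)
    0 0 0

/-- The quantities computed by the filter, per slot and user: estimation weights `T`, error
covariances `M`, gains `K`, and strategy coefficients `v`, `r`. -/
structure FilterRun (G : EnergyGame N) where
  T : ℕ → Fin N → Matrix (Aug N) (Aug N) ℝ
  M : ℕ → Fin N → Matrix (Aug N) (Aug N) ℝ
  K : ℕ → (i : Fin N) → Matrix (Aug N) (ObsIndex G.info i) ℝ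
  v : ℕ → Fin N → Aug N → ℝ
  r : ℕ → Fin N → ℝ

/-- Observation matrix of user `i` at slot `h`. As user `j` consumes `(Tⱼᵀ vⱼ) ⬝ g̃ + rⱼ`, what `i`
observes is `(obsMatrix)ᵀ g̃` up to an additive constant. -/
def obsMatrix (G : EnergyGame N) (R : FilterRun G) (h : ℕ) (i : Fin N) :
    Matrix (Aug N) (ObsIndex G.info i) ℝ :=
  Matrix.of fun a o => observe G.info i (fun j => ((R.T h j)ᵀ *ᵥ R.v h j) a) o

/-- `R` is a run of the sequential game filter over the time zone: the coefficients solve the linear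
equilibrium systems in every slot, and the weights and error covariances start at the prior ones
and follow the Kalman filter recursion. -/
structure IsFilterRun (G : EnergyGame N) (R : FilterRun G) : Prop where
  weights_init : ∀ i, R.T 0 i = initialWeights G i
  error_init : ∀ i, R.M 0 i = initialError G i
  linear_system : ∀ h < G.H, ∀ i,
    (R.T h i)ᵀ *ᵥ R.v h i
      + (rho G h * lam G h) •
        ∑ j ∈ Finset.univ.erase i, (R.T h i)ᵀ *ᵥ ((R.T h j)ᵀ *ᵥ R.v h j)
      = rho G h • Pi.single (Sum.inl i) 1
  constant_system : ∀ h < G.H, ∀ i,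
    R.r h i + rho G h * lam G h * ∑ j ∈ Finset.univ.erase i, R.r h j
      = -(rho G h * mu G h * G.omegaBar h)
  gain : ∀ h < G.H, ∀ i, ∃ B : Matrix (ObsIndex G.info i) (ObsIndex G.info i) ℝ,
    IsMoorePenrose ((obsMatrix G R h i)ᵀ * R.M h i * obsMatrix G R h i) B ∧
    R.K h i = R.M h i * obsMatrix G R h i * B
  weights_step : ∀ h, h + 1 < G.H → ∀ i,
    R.T (h + 1) i = R.T h i
      + R.K h i * ((obsMatrix G R h i)ᵀ - (obsMatrix G R h i)ᵀ * R.T h i)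
  error_step : ∀ h, h + 1 < G.H → ∀ i,
    R.M (h + 1) i = R.M h i - R.K h i * (obsMatrix G R h i)ᵀ * R.M h i

end DemandResponse

end

open DemandResponse

/-!
The idea is that everything the users ever observe is, up to constants and null sets, a linear form
in the Gaussian vector `g`, so that conditioning is orthogonal projection and the game reduces to
finite-dimensional linear algebra.

*Best responses.* The stage payoff is exactly quadratic in the own action (`payoff_update`), with
curvature `τ + α > 0`. A profile is therefore an equilibrium if and only if the marginal payoffs,
with the renewable term replaced by its mean, are orthogonal to all square-integrable functions of
the information (`IsStationary`, `IsBNE.isStationary`, `IsStationary.isBNE`). Tested against the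
difference of two solutions, these conditions give
`(2(τ+α) - λ) ∑ᵢ E[δᵢ²] + λ E[(∑ᵢ δᵢ)²] = 0`, and `0 ≤ λ < 2(τ+α)` forces `δ = 0`. As the
orthogonality conditions only see the information up to null sets, an induction over the slots
yields uniqueness (`IsStationary.play_ae_eq`).

*Filter.* With `S = E[g̃ g̃ᵀ]`, the invariant `IsLinearEstimator` says that `Tᵀ` is an idempotent
which is self-adjoint for the semi-inner product of `S`, that `M = (1 - T) S`, and that this
semi-inner product is definite on the range of `Tᵀ`. The Kalman update preserves it
(`IsLinearEstimator.update`), for singular covariances as well: the correction terms lie in the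
range of a pseudoinverse. Definiteness and the same coercivity as above make the equilibrium systems
injective, hence solvable (`exists_estimator_system_solution`), so that the filter has a run.

*Verification.* When the users play the linear strategies of a run, the estimation error
`(1 - T) g̃` is centred and uncorrelated with the own preference and with all past observations
(`IsFilterRun.error_mul_obsMatrix`). Being jointly Gaussian with them, it is independent of the
information (`indepFun_residual_infoAt`). Hence `T g̃` is the posterior mean, `M` is the error
covariance, and since the linear system makes the marginal payoff a linear form in the estimation
error (`marginalPayoff_filterProfile`), the strategies form an equilibrium. By uniqueness every
equilibrium agrees with this one almost surely.
-/

open DemandResponse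

noncomputable section

namespace DemandResponse

/-! ### Moore–Penrose pseudoinverses of symmetric matrices -/

section Pseudoinverse

variable {m n : Type*} [Fintype m] [Fintype n]

theorem IsMoorePenrose.transpose {A : Matrix m n ℝ} {B : Matrix n m ℝ}
    (h : IsMoorePenrose A B) : IsMoorePenrose Aᵀ Bᵀ where
  left := by rw [← transpose_mul, ← transpose_mul, ← Matrix.mul_assoc, h.left]
  right := by rw [← transpose_mul, ← transpose_mul, ← Matrix.mul_assoc, h.right]
  symm_left := by rw [← transpose_mul, transpose_transpose, h.symm_right]
  symm_right := by rw [← transpose_mul, transpose_transpose, h.symm_left]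

theorem IsMoorePenrose.unique {A : Matrix m n ℝ} {B C : Matrix n m ℝ}
    (hB : IsMoorePenrose A B) (hC : IsMoorePenrose A C) : B = C := by
  have h₁ : (A * C) * (A * B) = A * B := by rw [← Matrix.mul_assoc, hC.left]
  have h₂ : (A * B) * (A * C) = A * C := by rw [← Matrix.mul_assoc, hB.left]
  have h₃ : A * B = A * C := by
    rw [← h₁, ← hC.symm_left, ← hB.symm_left, ← transpose_mul, h₂]
  have h₄ : (B * A) * (C * A) = B * A := by rw [Matrix.mul_assoc, ← Matrix.mul_assoc A, hC.left]
  have h₅ : (C * A) * (B * A) = C * A := by rw [Matrix.mul_assoc, ← Matrix.mul_assoc A, hB.left]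
  have h₆ : B * A = C * A := by
    rw [← h₄, ← hC.symm_right, ← hB.symm_right, ← transpose_mul, h₅]
  rw [← hB.right, h₆, Matrix.mul_assoc, h₃, ← Matrix.mul_assoc, hC.right]

theorem IsMoorePenrose.isSymm {A B : Matrix n n ℝ} (h : IsMoorePenrose A B) (hA : Aᵀ = A) :
    Bᵀ = B := by
  have h' := h.transpose
  rw [hA] at h'
  exact h'.unique h

/-- A real symmetric matrix has a pseudoinverse: invert its nonzero eigenvalues. -/
theorem exists_isMoorePenrose_of_isSymm {A : Matrix n n ℝ} (hA : Aᵀ = A) :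
    ∃ B, IsMoorePenrose A B := by
  classical
  have hH : A.IsHermitian := by rw [IsHermitian, conjTranspose_eq_transpose_of_trivial, hA]
  obtain ⟨U, d, hU, hAU⟩ : ∃ (U : Matrix n n ℝ) (d : n → ℝ),
      Uᵀ * U = 1 ∧ A = U * diagonal d * Uᵀ := by
    refine ⟨hH.eigenvectorUnitary, hH.eigenvalues, ?_, ?_⟩
    · have := Unitary.coe_star_mul_self hH.eigenvectorUnitary
      rwa [star_eq_conjTranspose, conjTranspose_eq_transpose_of_trivial] at this
    · have := hH.spectral_theorem
      rwa [Unitary.conjStarAlgAut_apply, star_eq_conjTranspose,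
        conjTranspose_eq_transpose_of_trivial] at this
  have key : ∀ x y : n → ℝ, (U * diagonal x * Uᵀ) * (U * diagonal y * Uᵀ)
      = U * diagonal (fun i => x i * y i) * Uᵀ := fun x y => by
    calc _ = U * diagonal x * (Uᵀ * U) * diagonal y * Uᵀ := by simp only [Matrix.mul_assoc]
      _ = _ := by rw [hU, Matrix.mul_one, Matrix.mul_assoc U, diagonal_mul_diagonal]
  have symm : ∀ x : n → ℝ, (U * diagonal x * Uᵀ)ᵀ = U * diagonal x * Uᵀ := fun x => by
    simp [transpose_mul, Matrix.mul_assoc]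
  refine ⟨U * diagonal (fun i => (d i)⁻¹) * Uᵀ, ?_, ?_, ?_, ?_⟩ <;>
    simp only [hAU, key, symm, mul_inv_mul_cancel]
  congr 3
  ext i
  by_cases h : d i = 0 <;> simp [h]

end Pseudoinverse

/-! ### Exact linear estimators and the Kalman update -/

section Estimator

variable {n k : Type*} [Fintype n] [DecidableEq n] [Fintype k]

/-- For a random vector `X` with second moment matrix `S`, the matrix `T` describes a linear
estimator `T X` with error covariance `M`. Saying that `Tᵀ` is idempotent and self-adjoint for the
semi-inner product `x ⬝ S y` makes `T X` the orthogonal projection of `X` onto a space of linear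
forms. The condition `ker` says that this semi-inner product is definite on the range of `Tᵀ`; it
is what keeps the equilibrium systems solvable for a singular `S`. -/
structure IsLinearEstimator (S T M : Matrix n n ℝ) : Prop where
  idem : T * T = T
  error : M = (1 - T) * S
  symm : Mᵀ = M
  ker : ∀ v, S *ᵥ (Tᵀ *ᵥ v) = 0 → Tᵀ *ᵥ v = 0

namespace IsLinearEstimator

variable {S T M : Matrix n n ℝ}

theorem selfAdjoint (h : IsLinearEstimator S T M) (hS : Sᵀ = S) : S * Tᵀ = T * S := by
  have := h.symm
  rw [h.error, transpose_mul, hS, transpose_sub, transpose_one, Matrix.mul_sub, Matrix.sub_mul,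
    Matrix.mul_one,
    Matrix.one_mul] at this
  simpa using this

theorem error_eq (h : IsLinearEstimator S T M) (hS : Sᵀ = S) : M = S * (1 - T)ᵀ := by
  rw [transpose_sub, transpose_one, Matrix.mul_sub, Matrix.mul_one,
    h.selfAdjoint hS, h.error, Matrix.sub_mul, Matrix.one_mul]

theorem sub_mul_error (h : IsLinearEstimator S T M) : (1 - T) * M = M := by
  rw [h.error, ← Matrix.mul_assoc]
  congr 1
  rw [Matrix.mul_sub, Matrix.sub_mul, Matrix.sub_mul, h.idem]
  simp

theorem error_eq_conj (h : IsLinearEstimator S T M) (hS : Sᵀ = S) :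
    M = (1 - T) * S * (1 - T)ᵀ := by
  rw [Matrix.mul_assoc, ← h.error_eq hS, h.sub_mul_error]

theorem error_posSemidef (h : IsLinearEstimator S T M) (hS : S.PosSemidef) : M.PosSemidef := by
  have hS' : Sᵀ = S := by simpa [IsHermitian] using hS.isHermitian
  rw [h.error_eq_conj hS']
  rw [← conjTranspose_eq_transpose_of_trivial]
  exact hS.mul_mul_conjTranspose_same (1 - T)

theorem error_mulVec_eq_zero (h : IsLinearEstimator S T M) (hS : Sᵀ = S) {x : n → ℝ}
    (hx : Tᵀ *ᵥ x = x) : M *ᵥ x = 0 := by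
  rw [h.error_eq hS, ← mulVec_mulVec, transpose_sub, transpose_one, sub_mulVec, one_mulVec, hx,
    sub_self, mulVec_zero]

variable {A : Matrix n k ℝ} {B : Matrix k k ℝ}

/-- As `M` is positive semidefinite, `M A` vanishes on the kernel of `Aᵀ M A`, so that the
projection `(Aᵀ M A)⁺ (Aᵀ M A)` does not change it. -/
theorem error_mul_obs_mul_pinv (h : IsLinearEstimator S T M) (hS : S.PosSemidef)
    (hB : IsMoorePenrose (Aᵀ * M * A) B) : M * A * B * (Aᵀ * M * A) = M * A := by
  classical
  have hM := h.error_posSemidef hS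
  rw [← sub_eq_zero]
  have hfac : M * A * B * (Aᵀ * M * A) - M * A = M * (A * (B * (Aᵀ * M * A) - 1)) := by
    simp only [Matrix.mul_sub, Matrix.mul_one, Matrix.mul_assoc]
  have hzero : Aᵀ * M * A * (B * (Aᵀ * M * A) - 1) = 0 := by
    rw [Matrix.mul_sub, ← Matrix.mul_assoc, hB.left, Matrix.mul_one, sub_self]
  rw [hfac]
  refine ext_of_mulVec_single fun j => ?_
  set y := (B * (Aᵀ * M * A) - 1) *ᵥ Pi.single j 1 with hy
  have hz : (Aᵀ * M * A) *ᵥ y = 0 := by rw [hy, mulVec_mulVec, hzero, zero_mulVec]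
  have : M *ᵥ (A *ᵥ y) = 0 := by
    refine (hM.dotProduct_mulVec_zero_iff _).1 ?_
    have : A *ᵥ y ⬝ᵥ M *ᵥ (A *ᵥ y) = y ⬝ᵥ (Aᵀ * M * A) *ᵥ y := by
      rw [← mulVec_mulVec, ← mulVec_mulVec, dotProduct_mulVec y, vecMul_transpose]
    rw [star_trivial, this, hz, dotProduct_zero]
  rw [← mulVec_mulVec, ← mulVec_mulVec, ← hy, this, zero_mulVec]

variable (A B) in
/-- After the Kalman update the new error is uncorrelated with the observation just made. -/
theorem update_error_mul_obs (h : IsLinearEstimator S T M) (hS : S.PosSemidef)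
    (hB : IsMoorePenrose (Aᵀ * M * A) B) : (M - M * A * B * Aᵀ * M) * A = 0 := by
  have := h.error_mul_obs_mul_pinv hS hB
  rw [Matrix.sub_mul, sub_eq_zero]
  simpa only [Matrix.mul_assoc] using this.symm

/-- The Kalman update turns an exact linear estimator into another one. If `T'ᵀ v` is null for the
semi-inner product, so are its two orthogonal parts: the one in the old range vanishes by `ker`, and
the other is the image of a vector in the range of the pseudoinverse that `Aᵀ M A` annihilates. -/
theorem update (h : IsLinearEstimator S T M) (hS : S.PosSemidef)
    (hB : IsMoorePenrose (Aᵀ * M * A) B) :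
    IsLinearEstimator S (T + M * A * B * (Aᵀ - Aᵀ * T)) (M - M * A * B * Aᵀ * M) := by
  have hS' : Sᵀ = S := by simpa [IsHermitian] using hS.isHermitian
  have hBs : Bᵀ = B := hB.isSymm (by simp [transpose_mul, h.symm, Matrix.mul_assoc])
  have hT : 1 - (T + M * A * B * (Aᵀ - Aᵀ * T)) = (1 - M * A * B * Aᵀ) * (1 - T) := by
    simp only [Matrix.sub_mul, Matrix.mul_sub, Matrix.one_mul, Matrix.mul_one, Matrix.mul_assoc]
    abel
  have hres : (1 - T) * (M * A * B) = M * A * B := by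
    simp only [← Matrix.mul_assoc]
    rw [h.sub_mul_error]
  have hKK : M * A * B * Aᵀ * (M * A * B) = M * A * B := by
    calc _ = M * A * (B * (Aᵀ * M * A) * B) := by simp only [Matrix.mul_assoc]
      _ = _ := by rw [hB.right]
  have hQ : (1 - T) * (1 - T) = 1 - T := by
    rw [Matrix.mul_sub, Matrix.sub_mul, Matrix.sub_mul, h.idem]; simp
  refine ⟨?_, ?_, ?_, fun v hv => ?_⟩
  · -- idempotence is easier to see on the residual `1 - T`
    set T' := T + M * A * B * (Aᵀ - Aᵀ * T) with hT'
    set K := M * A * B with hK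
    have hQ' : (1 - T') * (1 - T') = 1 - T' := by
      rw [hT]
      calc (1 - K * Aᵀ) * (1 - T) * ((1 - K * Aᵀ) * (1 - T))
          = (1 - T) * (1 - T) - ((1 - T) * K) * Aᵀ * (1 - T)
              - K * Aᵀ * ((1 - T) * (1 - T)) + K * Aᵀ * ((1 - T) * K) * Aᵀ * (1 - T) := by
            generalize 1 - T = Q
            simp only [Matrix.sub_mul, Matrix.mul_sub, Matrix.one_mul, Matrix.mul_assoc]
            abel
        _ = (1 - K * Aᵀ) * (1 - T) := by
            rw [hQ, hres, hKK, Matrix.sub_mul, Matrix.one_mul]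
            abel
    have : T' * T' - T' = (1 - T') * (1 - T') - (1 - T') := by noncomm_ring
    rw [← sub_eq_zero, this, hQ', sub_self]
  · rw [hT, Matrix.mul_assoc (1 - _), ← h.error, Matrix.sub_mul, Matrix.one_mul]
  · simp only [transpose_sub, transpose_mul, h.symm, hBs, transpose_transpose, Matrix.mul_assoc]
  · -- split `T'ᵀ v` into its part in the old range and its `S`-orthogonal innovation part
    set y : k → ℝ := (M * A * B)ᵀ *ᵥ v with hy
    have hsplit : (T + M * A * B * (Aᵀ - Aᵀ * T))ᵀ *ᵥ v
        = Tᵀ *ᵥ v + (1 - T)ᵀ *ᵥ (A *ᵥ y) := by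
      rw [hy, transpose_add, add_mulVec, mulVec_mulVec, mulVec_mulVec]
      congr 2
      simp only [transpose_mul, transpose_sub, transpose_transpose, transpose_one,
        Matrix.sub_mul, Matrix.one_mul, Matrix.mul_assoc]
    have hSM : S *ᵥ ((1 - T)ᵀ *ᵥ (A *ᵥ y)) = M *ᵥ (A *ᵥ y) := by
      rw [mulVec_mulVec, ← h.error_eq hS']
    rw [hsplit] at hv ⊢
    rw [mulVec_add, hSM] at hv
    have hMA : M *ᵥ (A *ᵥ y) = 0 := by
      have := congrArg ((1 - T) *ᵥ ·) hv
      simp only [mulVec_add, mulVec_zero] at this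
      rw [mulVec_mulVec _ (1 - T) M, h.sub_mul_error, mulVec_mulVec _ S, h.selfAdjoint hS',
        mulVec_mulVec, ← Matrix.mul_assoc, Matrix.sub_mul, Matrix.one_mul, h.idem, sub_self,
        Matrix.zero_mul, zero_mulVec,
        zero_add] at this
      exact this
    have hy0 : y = 0 := by
      -- `y` lies in the range of `B`, on which `Aᵀ M A` is injective
      have h1 : B *ᵥ ((Aᵀ * M * A) *ᵥ y) = y := by
        have hyB : y = B *ᵥ (Aᵀ *ᵥ (M *ᵥ v)) := by
          rw [hy]; simp [transpose_mul, h.symm, hBs, mulVec_mulVec, Matrix.mul_assoc]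
        rw [hyB, mulVec_mulVec, mulVec_mulVec, hB.right]
      rw [← h1, ← mulVec_mulVec, ← mulVec_mulVec, hMA, mulVec_zero, mulVec_zero]
    rw [hMA, add_zero] at hv
    rw [h.ker v hv, hy0, mulVec_zero, mulVec_zero, add_zero]

/-- Linear forms that are already known exactly stay known. -/
theorem update_fixed (h : IsLinearEstimator S T M) (hS : S.PosSemidef) {x : n → ℝ}
    (hx : Tᵀ *ᵥ x = x) : (T + M * A * B * (Aᵀ - Aᵀ * T))ᵀ *ᵥ x = x := by
  have hS' : Sᵀ = S := by simpa [IsHermitian] using hS.isHermitian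
  rw [transpose_add, add_mulVec, hx, transpose_mul, ← mulVec_mulVec]
  simp only [transpose_mul, h.symm, Matrix.mul_assoc]
  rw [← mulVec_mulVec x Bᵀ, ← mulVec_mulVec x Aᵀ, h.error_mulVec_eq_zero hS' hx]
  simp

end IsLinearEstimator

/-- The equilibrium systems are solvable. With `B x y = x ⬝ S y`, pairing the homogeneous system with
`w` gives `(1 - c) ∑ᵢ B wᵢ wᵢ + c B (∑ᵢ wᵢ) (∑ᵢ wᵢ) = 0`, where `w` lies in the ranges of the `Tᵢᵀ`,
on which `B` is definite; so the system is injective. -/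
theorem exists_estimator_system_solution {ι : Type*} [Fintype ι] [DecidableEq ι]
    {S : Matrix n n ℝ} (hS : S.PosSemidef) {T M : ι → Matrix n n ℝ}
    (h : ∀ i, IsLinearEstimator S (T i) (M i)) {c : ℝ} (hc0 : 0 ≤ c) (hc1 : c < 1)
    (b : ι → n → ℝ) (hb : ∀ i, (T i)ᵀ *ᵥ b i = b i) :
    ∃ w : ι → n → ℝ, ∀ i, (T i)ᵀ *ᵥ w i = w i ∧
      w i + c • ∑ j ∈ Finset.univ.erase i, (T i)ᵀ *ᵥ w j = b i := by
  have hS' : Sᵀ = S := by simpa [IsHermitian] using hS.isHermitian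
  let L : (ι → n → ℝ) →ₗ[ℝ] (ι → n → ℝ) := LinearMap.pi fun i =>
    LinearMap.proj i + c • ∑ j ∈ Finset.univ.erase i, (mulVecLin (T i)ᵀ) ∘ₗ LinearMap.proj j
  have hL : ∀ w i, L w i = w i + c • ∑ j ∈ Finset.univ.erase i, (T i)ᵀ *ᵥ w j := fun w i => by
    simp [L, mulVec_transpose, -Finset.sum_erase_eq_sub]
  have hidem : ∀ i x, (T i)ᵀ *ᵥ ((T i)ᵀ *ᵥ x) = (T i)ᵀ *ᵥ x := fun i x => by
    rw [mulVec_mulVec, ← transpose_mul, (h i).idem]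
  have hfix : ∀ (w : ι → n → ℝ) b, (∀ i, (T i)ᵀ *ᵥ b i = b i) → L w = b →
      ∀ i, (T i)ᵀ *ᵥ w i = w i := by
    intro w b hb hw i
    have hwi : w i = b i - c • ∑ j ∈ Finset.univ.erase i, (T i)ᵀ *ᵥ w j := by
      rw [← hw, hL]; simp
    rw [hwi, mulVec_sub, mulVec_smul, mulVec_sum, hb]
    simp only [hidem]
  have hinj : Function.Injective L := by
    rw [← LinearMap.ker_eq_bot, LinearMap.ker_eq_bot']
    intro w hw
    have hw' := hfix w 0 (by simp) hw
    have hB : ∀ i j, w i ⬝ᵥ S *ᵥ ((T i)ᵀ *ᵥ w j) = w i ⬝ᵥ S *ᵥ w j := fun i j => by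
      rw [mulVec_mulVec, (h i).selfAdjoint hS', ← mulVec_mulVec, dotProduct_mulVec,
        ← mulVec_transpose, hw']
    have hi : ∀ i, (1 - c) * (w i ⬝ᵥ S *ᵥ w i) + c * (w i ⬝ᵥ S *ᵥ ∑ j, w j) = 0 := fun i => by
      have h0 : w i ⬝ᵥ S *ᵥ (L w i) = 0 := by rw [hw]; simp
      rw [hL, mulVec_add, mulVec_smul, mulVec_sum, dotProduct_add, dotProduct_smul, dotProduct_sum]
        at h0
      simp only [hB] at h0
      rw [← Finset.add_sum_erase _ _ (Finset.mem_univ i), mulVec_add, dotProduct_add,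
        mulVec_sum, dotProduct_sum]
      rw [smul_eq_mul] at h0
      linarith
    have hsum : (1 - c) * ∑ i, w i ⬝ᵥ S *ᵥ w i + c * ((∑ i, w i) ⬝ᵥ S *ᵥ ∑ j, w j) = 0 := by
      rw [sum_dotProduct, Finset.mul_sum, Finset.mul_sum, ← Finset.sum_add_distrib]
      exact Finset.sum_eq_zero fun i _ => hi i
    have hpos : ∀ x, 0 ≤ x ⬝ᵥ S *ᵥ x := fun x => by simpa using hS.dotProduct_mulVec_nonneg x
    have hz : ∑ i, w i ⬝ᵥ S *ᵥ w i = 0 := by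
      have h1 := mul_nonneg hc0 (hpos (∑ i, w i))
      have h2 : 0 ≤ ∑ i, w i ⬝ᵥ S *ᵥ w i := Finset.sum_nonneg fun i _ => hpos _
      nlinarith
    funext i
    have hzi := (Finset.sum_eq_zero_iff_of_nonneg fun i _ => hpos (w i)).1 hz i (Finset.mem_univ i)
    have hSw : S *ᵥ w i = 0 := (hS.dotProduct_mulVec_zero_iff _).1 (by simpa using hzi)
    have := (h i).ker (w i) (by rw [hw' i, hSw])
    rw [hw' i] at this
    exact this
  obtain ⟨w, hw⟩ := (LinearMap.injective_iff_surjective.1 hinj) b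
  exact ⟨w, fun i => ⟨hfix w b hb hw i, by rw [← hL, hw]⟩⟩

end Estimator

variable {N : ℕ} {Ω : Type*} [MeasurableSpace Ω]

theorem integrable_fun_mul {P : Measure Ω} {a b : Ω → ℝ} (ha : MemLp a 2 P) (hb : MemLp b 2 P) :
    Integrable (fun x => a x * b x) P := ha.integrable_mul hb

/-! ### Play and information -/

theorem play_eq (G : EnergyGame N) (s : Profile G) (γ : Fin N → ℝ) (h : ℕ) (i : Fin N) :
    play G s γ h i = s h i (infoAt G s γ h i) := by
  rw [play]
  rfl

theorem measurable_observe (m : InfoModel N) (i : Fin N) : Measurable (observe m i) := by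
  refine measurable_pi_lambda _ fun o => ?_
  cases m with
  | priv => exact nomatch (o : Empty)
  | share E => exact measurable_pi_apply _
  | broadcast => exact Finset.measurable_sum _ fun j _ => measurable_pi_apply j

section Measurability

variable {G : EnergyGame N} {s : Profile G}

theorem measurable_infoAt_of_play {h : ℕ}
    (hp : ∀ t < h, Measurable fun γ => play G s γ t) (i : Fin N) :
    Measurable fun γ => infoAt G s γ h i :=
  (measurable_pi_apply i).prodMk <|
    measurable_pi_lambda _ fun t => (measurable_observe _ _).comp (hp t t.2)

theorem measurable_play (hs : ∀ h < G.H, ∀ i, Measurable (s h i)) {h : ℕ} (hh : h < G.H) :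
    Measurable fun γ => play G s γ h := by
  induction h using Nat.strong_induction_on with
  | _ h ih =>
    refine measurable_pi_lambda _ fun i => ?_
    simp only [play_eq]
    exact (hs h hh i).comp (measurable_infoAt_of_play (fun t ht => ih t ht (ht.trans hh)) i)

theorem measurable_infoAt (hs : ∀ h < G.H, ∀ i, Measurable (s h i)) {h : ℕ} (hh : h < G.H)
    (i : Fin N) : Measurable fun γ => infoAt G s γ h i :=
  measurable_infoAt_of_play (fun _ ht => measurable_play hs (ht.trans hh)) i

end Measurability

/-! ### The stage payoff as a quadratic function of the own action -/

/-- Derivative of the stage payoff of user `i` in its own consumption. -/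
def marginalPayoff (G : EnergyGame N) (h : ℕ) (i : Fin N) (l g : Fin N → ℝ) (w : ℝ) : ℝ :=
  g i - 2 * (tau G h + G.alpha h) * l i - lam G h * ∑ j ∈ Finset.univ.erase i, l j - mu G h * w

theorem aggregateUtility_eq (G : EnergyGame N) (h : ℕ) (l g : Fin N → ℝ) (w : ℝ) :
    aggregateUtility G h l g w =
      -((∑ j, l j) * price G h (∑ j, l j) w) + ∑ j, (g j * l j - G.alpha h * l j ^ 2) := by
  simp only [aggregateUtility, utility, add_sub_assoc, Finset.sum_add_distrib,
    Finset.sum_neg_distrib, Finset.sum_mul]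

/-- The stage payoff is exactly quadratic in the own action. -/
theorem payoff_update (G : EnergyGame N) (h : ℕ) (i : Fin N) (l g : Fin N → ℝ) (w d : ℝ) :
    payoff G h i (Function.update l i d) g w = payoff G h i l g w
      + ((d - l i) * marginalPayoff G h i l g w - (tau G h + G.alpha h) * (d - l i) ^ 2) := by
  have h1 : ∑ j, Function.update l i d j = d + ∑ j ∈ Finset.univ.erase i, l j := by
    rw [← Finset.add_sum_erase _ _ (Finset.mem_univ i), Function.update_self]
    congr 1
    exact Finset.sum_congr rfl fun j hj => Function.update_of_ne (Finset.ne_of_mem_erase hj) _ _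
  have h2 : ∑ j, (g j * Function.update l i d j - G.alpha h * Function.update l i d j ^ 2)
      = (g i * d - G.alpha h * d ^ 2)
        + ∑ j ∈ Finset.univ.erase i, (g j * l j - G.alpha h * l j ^ 2) := by
    rw [← Finset.add_sum_erase _ _ (Finset.mem_univ i), Function.update_self]
    congr 1
    refine Finset.sum_congr rfl fun j hj => ?_
    rw [Function.update_of_ne (Finset.ne_of_mem_erase hj)]
  have h3 := (Finset.add_sum_erase _ l (Finset.mem_univ i)).symm
  have h4 := (Finset.add_sum_erase _ (fun j => g j * l j - G.alpha h * l j ^ 2)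
    (Finset.mem_univ i)).symm
  unfold payoff marginalPayoff lam mu tau
  cases G.behavior with
  | selfish =>
    simp only [utility, price, Function.update_self, h1, h3]
    ring
  | altruistic =>
    simp only [aggregateUtility_eq, price, h1, h2, h3, h4]
    ring
  | welfare =>
    simp only [welfareValue, netRevenue, aggregateUtility_eq, price, h1, h2, h3, h4]
    ring

/-! ### The probabilistic model -/

/-- The standing assumptions: positive parameters, Gaussian preferences with the prescribed mean and
covariances, and integrable renewable terms with the prescribed means, independent of the
preferences. -/
structure IsGaussianModel (G : EnergyGame N) (P : Measure Ω) (g : Ω → Fin N → ℝ) (ω : ℕ → Ω → ℝ) :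
    Prop where
  gamma_pos : ∀ h < G.H, 0 < G.gamma h
  kappa_pos : ∀ h < G.H, 0 < G.kappa h
  alpha_pos : ∀ h < G.H, 0 < G.alpha h
  gBar_pos : 0 < G.gBar
  measurable_pref : Measurable g
  gaussian : HasGaussianLaw g P
  mean : ∀ i, ∫ x, g x i ∂P = G.gBar
  covariance : ∀ i j, cov[fun x => g x i, fun x => g x j; P] = G.cov i j
  var_pos : ∀ i, 0 < G.cov i i
  integrable_renewable : ∀ h < G.H, Integrable (ω h) P
  mean_renewable : ∀ h < G.H, ∫ x, ω h x ∂P = G.omegaBar h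
  indep : ∀ h < G.H, IndepFun g (ω h) P

namespace IsGaussianModel

variable {G : EnergyGame N} {P : Measure Ω} {g : Ω → Fin N → ℝ} {ω : ℕ → Ω → ℝ}

theorem tau_nonneg (hG : IsGaussianModel G P g ω) {h : ℕ} (hh : h < G.H) : 0 ≤ tau G h := by
  have h1 := (hG.gamma_pos h hh).le
  have h2 := (hG.kappa_pos h hh).le
  unfold tau
  cases G.behavior <;> positivity

theorem curvature_pos (hG : IsGaussianModel G P g ω) {h : ℕ} (hh : h < G.H) :
    0 < tau G h + G.alpha h :=
  add_pos_of_nonneg_of_pos (hG.tau_nonneg hh) (hG.alpha_pos h hh)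

theorem lam_nonneg (hG : IsGaussianModel G P g ω) {h : ℕ} (hh : h < G.H) : 0 ≤ lam G h := by
  have h1 := (hG.gamma_pos h hh).le
  have h2 := (hG.kappa_pos h hh).le
  unfold lam
  cases G.behavior <;> positivity

/-- The interaction coefficient is dominated by the own curvature. -/
theorem lam_lt (hG : IsGaussianModel G P g ω) {h : ℕ} (hh : h < G.H) :
    lam G h < 2 * (tau G h + G.alpha h) := by
  have h0 : lam G h ≤ 2 * tau G h := by
    have ht := hG.tau_nonneg hh
    unfold lam
    unfold tau at ht ⊢
    cases hb : G.behavior <;> simp only [hb] at ht ⊢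
    · linarith
    · exact le_of_eq (by ring)
    · exact le_of_eq (by ring)
  linarith [hG.alpha_pos h hh]

theorem memLp_pref (hG : IsGaussianModel G P g ω) (i : Fin N) : MemLp (fun x => g x i) 2 P :=
  hG.gaussian.memLp_two.eval i

theorem integral_mul_renewable (hG : IsGaussianModel G P g ω) {h : ℕ} (hh : h < G.H)
    {f : (Fin N → ℝ) → ℝ} (hf : Measurable f) :
    ∫ x, f (g x) * ω h x ∂P = ∫ x, f (g x) * G.omegaBar h ∂P := by
  have := (hG.indep h hh).integral_fun_comp_mul_comp (f := f) (g := id)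
    hG.measurable_pref.aemeasurable (hG.integrable_renewable h hh).aemeasurable
    hf.aestronglyMeasurable measurable_id.aestronglyMeasurable
  simp only [id] at this
  rw [this, hG.mean_renewable h hh, integral_mul_const]

variable [IsProbabilityMeasure P]

theorem integrable_mul_renewable (hG : IsGaussianModel G P g ω) {h : ℕ} (hh : h < G.H)
    {f : (Fin N → ℝ) → ℝ} (hf : Measurable f) (hfL : MemLp (fun x => f (g x)) 2 P) :
    Integrable (fun x => f (g x) * ω h x) P :=
  ((hG.indep h hh).comp hf measurable_id).integrable_mul (hfL.integrable (by norm_num))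
    (hG.integrable_renewable h hh)

section Payoff

variable {h : ℕ} {u : (Fin N → ℝ) → Fin N → ℝ}

theorem integrable_payoff (hG : IsGaussianModel G P g ω) (hh : h < G.H)
    (hu : Measurable u) (huL : ∀ j, MemLp (fun x => u (g x) j) 2 P) (i : Fin N) :
    Integrable (fun x => payoff G h i (u (g x)) (g x) (ω h x)) P := by
  have huj : ∀ j, Measurable fun γ => u γ j := fun j => (measurable_pi_apply j).comp hu
  have hsum : MemLp (fun x => ∑ j, u (g x) j) 2 P := memLp_finsetSum _ fun j _ => huL j
  have hprice : ∀ f : (Fin N → ℝ) → ℝ, Measurable f → MemLp (fun x => f (g x)) 2 P →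
      Integrable (fun x => f (g x) * price G h (∑ j, u (g x) j) (ω h x)) P := by
    intro f hf hfL
    have h1 := (hfL.integrable_mul hsum).const_mul (G.gamma h / N)
    have h2 := (hG.integrable_mul_renewable hh hf hfL).const_mul (G.gamma h / N)
    refine (h1.add h2).congr (ae_of_all _ fun x => ?_)
    simp only [price, Pi.add_apply, Pi.mul_apply]
    ring
  have hquad : ∀ j, Integrable (fun x => g x j * u (g x) j - G.alpha h * u (g x) j ^ 2) P :=
    fun j => ((hG.memLp_pref j).integrable_mul (huL j)).sub ((huL j).integrable_sq.const_mul _)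
  have hut : ∀ j, Integrable (fun x => utility G h j (u (g x)) (g x) (ω h x)) P := fun j => by
    refine ((hprice _ (huj j) (huL j)).neg.add (hquad j)).congr (ae_of_all _ fun x => ?_)
    simp only [utility, Pi.add_apply, Pi.neg_apply]
    ring
  have hagg : Integrable (fun x => aggregateUtility G h (u (g x)) (g x) (ω h x)) P :=
    integrable_finsetSum _ fun j _ => hut j
  unfold payoff
  cases G.behavior with
  | selfish => exact hut i
  | altruistic => exact hagg
  | welfare =>
    refine hagg.add (.sub ?_ (hsum.integrable_sq.const_mul _))
    refine (hprice (fun γ => ∑ j, u γ j) (by fun_prop) hsum).congr (ae_of_all _ fun x => ?_)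
    simp only [mul_comm]

theorem memLp_marginalPayoff (hG : IsGaussianModel G P g ω)
    (huL : ∀ j, MemLp (fun x => u (g x) j) 2 P) (i : Fin N) (w : ℝ) :
    MemLp (fun x => marginalPayoff G h i (u (g x)) (g x) w) 2 P :=
  (((hG.memLp_pref i).sub ((huL i).const_mul _)).sub
    ((memLp_finsetSum _ fun j _ => huL j).const_mul _)).sub (memLp_const _)

theorem mul_marginalPayoff_eq (f : ℝ) (i : Fin N) (l γ : Fin N → ℝ) (w : ℝ) :
    f * marginalPayoff G h i l γ w =
      f * marginalPayoff G h i l γ (G.omegaBar h)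
        - mu G h * (f * w - f * G.omegaBar h) := by
  unfold marginalPayoff
  ring

theorem integrable_mul_marginalPayoff (hG : IsGaussianModel G P g ω) (hh : h < G.H)
    (huL : ∀ j, MemLp (fun x => u (g x) j) 2 P) (i : Fin N)
    {f : (Fin N → ℝ) → ℝ} (hf : Measurable f) (hfL : MemLp (fun x => f (g x)) 2 P) :
    Integrable (fun x => f (g x) * marginalPayoff G h i (u (g x)) (g x) (ω h x)) P := by
  have := (integrable_fun_mul hfL (hG.memLp_marginalPayoff (h := h) huL i (G.omegaBar h))).sub
    (((hG.integrable_mul_renewable hh hf hfL).sub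
      ((hfL.integrable (by norm_num)).mul_const (G.omegaBar h))).const_mul (mu G h))
  exact this.congr (ae_of_all _ fun x => (mul_marginalPayoff_eq _ i _ _ _).symm)

/-- Independence lets the renewable term be replaced by its mean. -/
theorem integral_mul_marginalPayoff (hG : IsGaussianModel G P g ω) (hh : h < G.H)
    (huL : ∀ j, MemLp (fun x => u (g x) j) 2 P) (i : Fin N)
    {f : (Fin N → ℝ) → ℝ} (hf : Measurable f) (hfL : MemLp (fun x => f (g x)) 2 P) :
    ∫ x, f (g x) * marginalPayoff G h i (u (g x)) (g x) (ω h x) ∂P =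
      ∫ x, f (g x) * marginalPayoff G h i (u (g x)) (g x) (G.omegaBar h) ∂P := by
  have h1 := hG.integrable_mul_renewable hh hf hfL
  have h2 : Integrable (fun x => f (g x) * G.omegaBar h) P :=
    (hfL.integrable (by norm_num)).mul_const _
  have h3 : Integrable (fun x => mu G h * (f (g x) * ω h x - f (g x) * G.omegaBar h)) P :=
    (h1.sub h2).const_mul _
  rw [integral_congr_ae (ae_of_all _ fun x => mul_marginalPayoff_eq _ i _ _ _),
    integral_sub (integrable_fun_mul hfL (hG.memLp_marginalPayoff huL i _)) h3, integral_const_mul,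
    integral_sub h1 h2,
    hG.integral_mul_renewable hh hf, sub_self, mul_zero, sub_zero]

end Payoff

end IsGaussianModel

/-! ### Equilibrium as orthogonality of the marginal payoffs -/

/-- First-order condition of equilibrium in weak form: at every slot the marginal payoff of user
`i`, with the renewable term replaced by its mean, is orthogonal to every square-integrable function
of the information of `i`. Unlike a conditional expectation, this is visibly insensitive to null
modifications of the information. -/
def IsStationary (G : EnergyGame N) (P : Measure Ω) (g : Ω → Fin N → ℝ) (s : Profile G) : Prop :=
  ∀ h < G.H, ∀ i, ∀ f : Info G h i → ℝ, Measurable f →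
    MemLp (fun x => f (infoAt G s (g x) h i)) 2 P →
    ∫ x, f (infoAt G s (g x) h i) *
      marginalPayoff G h i (play G s (g x) h) (g x) (G.omegaBar h) ∂P = 0

section Equilibrium

variable {G : EnergyGame N} {P : Measure Ω} {g : Ω → Fin N → ℝ} {ω : ℕ → Ω → ℝ}
  [IsProbabilityMeasure P] {s : Profile G}

theorem infoSigma_le (hg : Measurable g) (hs : ∀ h < G.H, ∀ i, Measurable (s h i)) {h : ℕ}
    (hh : h < G.H) (i : Fin N) : infoSigma G s g h i ≤ ‹MeasurableSpace Ω› :=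
  ((measurable_infoAt hs hh i).comp hg).comap_le

theorem eq_zero_of_forall_mul_le_sq_mul {a b : ℝ} (hb : 0 ≤ b) (h : ∀ t : ℝ, t * a ≤ t ^ 2 * b) :
    a = 0 := by
  have h1 := h (a / (b + 1))
  have hb1 : 0 < b + 1 := by linarith
  have h2 : a ^ 2 * (b + 1) ≤ a ^ 2 * b := by
    rw [div_mul_eq_mul_div, div_pow, div_mul_eq_mul_div, div_le_div_iff₀ hb1 (by positivity)] at h1
    have : a * a * (b + 1) * (b + 1) ≤ a ^ 2 * b * (b + 1) := by linarith
    have := le_of_mul_le_mul_right this hb1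
    linarith
  nlinarith [sq_nonneg a]

theorem payoff_update_play {h : ℕ} {i : Fin N} (d : Info G h i → ℝ) (γ : Fin N → ℝ) (w : ℝ) :
    payoff G h i (Function.update (play G s γ h) i (d (infoAt G s γ h i))) γ w
      = payoff G h i (play G s γ h) γ w
        + ((d (infoAt G s γ h i) - s h i (infoAt G s γ h i))
            * marginalPayoff G h i (play G s γ h) γ w
          - (tau G h + G.alpha h) * (d (infoAt G s γ h i) - s h i (infoAt G s γ h i)) ^ 2) := by
  rw [payoff_update, play_eq]

theorem IsBNE.isStationary (hG : IsGaussianModel G P g ω) (hs : IsBNE G P g ω s) :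
    IsStationary G P g s := by
  intro h hh i f hf hfL
  have hI := measurable_infoAt hs.measurable hh i
  have hfI : Measurable fun γ => f (infoAt G s γ h i) := hf.comp hI
  have huL := hs.memLp h hh
  have hu := measurable_play hs.measurable hh
  have hle := infoSigma_le hG.measurable_pref hs.measurable hh i
  refine eq_zero_of_forall_mul_le_sq_mul
    (b := (tau G h + G.alpha h) * ∫ x, f (infoAt G s (g x) h i) ^ 2 ∂P)
    (mul_nonneg (hG.curvature_pos hh).le (integral_nonneg fun x => sq_nonneg _)) fun t => ?_
  have hopt := hs.optimal h hh i (fun y => s h i y + t * f y)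
    ((hs.measurable h hh i).add (hf.const_mul t)) (by
      have := (huL i).add (hfL.const_mul t)
      simpa only [play_eq] using! this)
  have hint := integral_mono_ae integrable_condExp integrable_condExp hopt
  rw [integral_condExp hle, integral_condExp hle] at hint
  simp only [payoff_update_play (d := fun y => s h i y + t * f y), add_sub_cancel_left] at hint
  have hm := hG.integrable_mul_marginalPayoff (u := fun γ => play G s γ h) hh huL i hfI hfL
  have heq : ∀ x, t * f (infoAt G s (g x) h i)
        * marginalPayoff G h i (play G s (g x) h) (g x) (ω h x)
      - (tau G h + G.alpha h) * (t * f (infoAt G s (g x) h i)) ^ 2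
      = t * (f (infoAt G s (g x) h i) * marginalPayoff G h i (play G s (g x) h) (g x) (ω h x))
        - t ^ 2 * (tau G h + G.alpha h) * f (infoAt G s (g x) h i) ^ 2 := fun x => by ring
  simp only [heq] at hint
  have hq : Integrable (fun x => t ^ 2 * (tau G h + G.alpha h) * f (infoAt G s (g x) h i) ^ 2) P :=
    hfL.integrable_sq.const_mul _
  have hmq : Integrable (fun x =>
      t * (f (infoAt G s (g x) h i) * marginalPayoff G h i (play G s (g x) h) (g x) (ω h x))
        - t ^ 2 * (tau G h + G.alpha h) * f (infoAt G s (g x) h i) ^ 2) P :=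
    (hm.const_mul t).sub hq
  rw [integral_add (hG.integrable_payoff hh hu huL i) hmq,
    integral_sub (hm.const_mul t) hq, integral_const_mul,
    integral_const_mul,
    hG.integral_mul_marginalPayoff (u := fun γ => play G s γ h) hh huL i hfI hfL] at hint
  linarith

theorem IsStationary.isBNE (hG : IsGaussianModel G P g ω)
    (hsm : ∀ h < G.H, ∀ i, Measurable (s h i))
    (hsL : ∀ h < G.H, ∀ i, MemLp (fun x => play G s (g x) h i) 2 P)
    (hs : IsStationary G P g s) : IsBNE G P g ω s := by
  refine ⟨hsm, hsL, fun h hh i d hd hdL => ?_⟩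
  have hI := measurable_infoAt hsm hh i
  have hu := measurable_play hsm hh
  have huL := hsL h hh
  have hle := infoSigma_le hG.measurable_pref hsm hh i
  have hdI : Measurable fun γ => d (infoAt G s γ h i) := hd.comp hI
  have hint₁ : Integrable (fun x => payoff G h i
      (Function.update (play G s (g x) h) i (d (infoAt G s (g x) h i))) (g x) (ω h x)) P := by
    refine hG.integrable_payoff (u := fun γ =>
      Function.update (play G s γ h) i (d (infoAt G s γ h i))) hh ?_ ?_ i
    · refine measurable_pi_lambda _ fun j => ?_
      by_cases hj : j = i
      · subst hj; simpa only [Function.update_self] using hdI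
      · simpa only [Function.update_of_ne hj] using! (measurable_pi_apply j).comp hu
    · intro j
      by_cases hj : j = i
      · subst hj; simpa only [Function.update_self] using hdL
      · simpa only [Function.update_of_ne hj] using huL j
  have hint₂ := hG.integrable_payoff hh hu huL i
  refine ae_le_of_ae_le_trim (hm := hle) ?_
  refine ae_le_of_forall_setIntegral_le
    (integrable_condExp.trim hle stronglyMeasurable_condExp)
    (integrable_condExp.trim hle stronglyMeasurable_condExp) fun A hA _ => ?_
  rw [← setIntegral_trim hle stronglyMeasurable_condExp hA,
    ← setIntegral_trim hle stronglyMeasurable_condExp hA,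
    setIntegral_condExp hle hint₁ hA, setIntegral_condExp hle hint₂ hA]
  obtain ⟨C, hC, rfl⟩ := hA
  -- test stationarity with the deviation restricted to the event `C`
  set f : Info G h i → ℝ := C.indicator fun y => d y - s h i y with hf_def
  have hf : Measurable f := (hd.sub (hsm h hh i)).indicator hC
  have hfI : Measurable fun γ => f (infoAt G s γ h i) := hf.comp hI
  have hdiff : MemLp (fun x => d (infoAt G s (g x) h i) - s h i (infoAt G s (g x) h i)) 2 P := by
    have := hdL.sub (huL i)
    simpa only [play_eq] using! this
  have hA' : MeasurableSet ((fun x => infoAt G s (g x) h i) ⁻¹' C) :=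
    (hI.comp hG.measurable_pref) hC
  have hfL : MemLp (fun x => f (infoAt G s (g x) h i)) 2 P := by
    exact hdiff.indicator hA'
  have hzero := hs h hh i f hf hfL
  have hm := hG.integrable_mul_marginalPayoff (u := fun γ => play G s γ h) hh huL i hfI hfL
  rw [← hG.integral_mul_marginalPayoff (u := fun γ => play G s γ h) hh huL i hfI hfL] at hzero
  rw [← integral_indicator hA', ← integral_indicator hA']
  have hkey : ∀ x, ((fun x => infoAt G s (g x) h i) ⁻¹' C).indicator (fun x => payoff G h i
      (Function.update (play G s (g x) h) i (d (infoAt G s (g x) h i))) (g x) (ω h x)) x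
      ≤ ((fun x => infoAt G s (g x) h i) ⁻¹' C).indicator
          (fun x => payoff G h i (play G s (g x) h) (g x) (ω h x)) x
        + f (infoAt G s (g x) h i)
          * marginalPayoff G h i (play G s (g x) h) (g x) (ω h x) := by
    intro x
    by_cases hx : infoAt G s (g x) h i ∈ C
    · have hx' : x ∈ (fun x => infoAt G s (g x) h i) ⁻¹' C := hx
      rw [Set.indicator_of_mem hx', Set.indicator_of_mem hx', payoff_update_play, hf_def,
        Set.indicator_of_mem hx]
      have := mul_nonneg (hG.curvature_pos hh).le
        (sq_nonneg (d (infoAt G s (g x) h i) - s h i (infoAt G s (g x) h i)))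
      linarith
    · have hx' : x ∉ (fun x => infoAt G s (g x) h i) ⁻¹' C := hx
      rw [Set.indicator_of_notMem hx', Set.indicator_of_notMem hx', hf_def,
        Set.indicator_of_notMem hx]
      simp
  have hle' := integral_mono (hint₁.indicator hA') ((hint₂.indicator hA').add hm) hkey
  rw [integral_add' (hint₂.indicator hA') hm] at hle'
  exact hle'.trans_eq (by rw [hzero, add_zero])

end Equilibrium

/-! ### Uniqueness -/

theorem infoAt_ae_eq {G : EnergyGame N} {P : Measure Ω} {g : Ω → Fin N → ℝ} {s s' : Profile G}
    {h : ℕ}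
    (hp : ∀ t < h, ∀ᵐ x ∂P, play G s' (g x) t = play G s (g x) t) (i : Fin N) :
    ∀ᵐ x ∂P, infoAt G s' (g x) h i = infoAt G s (g x) h i := by
  have : ∀ᵐ x ∂P, ∀ t : Fin h, play G s' (g x) t = play G s (g x) t :=
    ae_all_iff.2 fun t => hp t t.2
  filter_upwards [this] with x hx
  simp only [infoAt, hx]

/-- The coercivity behind uniqueness: differences of two solutions of the first-order conditions,
paired with themselves, give `(2(τ+α) - λ) ∑ᵢ E[δᵢ²] + λ E[(∑ᵢ δᵢ)²] = 0`. -/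
theorem ae_eq_zero_of_integral_system {P : Measure Ω} {ι : Type*} [Fintype ι]
    [DecidableEq ι] {δ : ι → Ω → ℝ}
    (hδ : ∀ i, MemLp (δ i) 2 P) {a c : ℝ} (hc : 0 ≤ c) (hac : c < a)
    (h : ∀ i, ∫ x, δ i x * (a * δ i x + c * ∑ j ∈ Finset.univ.erase i, δ j x) ∂P = 0) (i : ι) :
    δ i =ᵐ[P] 0 := by
  have hsq : ∀ i, Integrable (fun x => δ i x ^ 2) P := fun i => (hδ i).integrable_sq
  have hS : MemLp (fun x => ∑ j, δ j x) 2 P := memLp_finsetSum _ fun j _ => hδ j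
  have hi : ∀ i, (a - c) * ∫ x, δ i x ^ 2 ∂P + c * ∫ x, δ i x * ∑ j, δ j x ∂P = 0 := fun i => by
    rw [← h i, ← integral_const_mul, ← integral_const_mul,
      ← integral_add ((hsq i).const_mul _) ((integrable_fun_mul (hδ i) hS).const_mul _)]
    refine integral_congr_ae (ae_of_all _ fun x => ?_)
    simp only
    rw [← Finset.add_sum_erase _ (fun j => δ j x) (Finset.mem_univ i)]
    ring
  have hsum : (a - c) * ∑ i, ∫ x, δ i x ^ 2 ∂P + c * ∫ x, (∑ j, δ j x) ^ 2 ∂P = 0 := by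
    have : ∫ x, (∑ j, δ j x) ^ 2 ∂P = ∑ i, ∫ x, δ i x * ∑ j, δ j x ∂P := by
      rw [← integral_finsetSum _ fun i _ => integrable_fun_mul (hδ i) hS]
      simp only [sq, Finset.sum_mul]
    rw [this, Finset.mul_sum, Finset.mul_sum, ← Finset.sum_add_distrib]
    exact Finset.sum_eq_zero fun i _ => hi i
  have hnn : ∀ i, 0 ≤ ∫ x, δ i x ^ 2 ∂P := fun i => integral_nonneg fun x => sq_nonneg _
  have hz : ∑ i, ∫ x, δ i x ^ 2 ∂P = 0 := by
    have h1 := mul_nonneg hc (integral_nonneg (μ := P) fun x => sq_nonneg (∑ j, δ j x))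
    have h2 := Finset.sum_nonneg fun i (_ : i ∈ Finset.univ) => hnn i
    nlinarith
  have hzi := (Finset.sum_eq_zero_iff_of_nonneg fun i _ => hnn i).1 hz i (Finset.mem_univ i)
  rw [integral_eq_zero_iff_of_nonneg (fun x => sq_nonneg _) (hsq i)] at hzi
  filter_upwards [hzi] with x hx
  simpa using hx

section Uniqueness

variable {G : EnergyGame N} {P : Measure Ω} {g : Ω → Fin N → ℝ} {ω : ℕ → Ω → ℝ}
  [IsProbabilityMeasure P]

theorem IsStationary.play_ae_eq (hG : IsGaussianModel G P g ω) {s s' : Profile G}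
    (hsm : ∀ h < G.H, ∀ i, Measurable (s h i)) (hsm' : ∀ h < G.H, ∀ i, Measurable (s' h i))
    (hsL : ∀ h < G.H, ∀ i, MemLp (fun x => play G s (g x) h i) 2 P)
    (hsL' : ∀ h < G.H, ∀ i, MemLp (fun x => play G s' (g x) h i) 2 P)
    (hs : IsStationary G P g s) (hs' : IsStationary G P g s') {h : ℕ} (hh : h < G.H) :
    ∀ᵐ x ∂P, play G s' (g x) h = play G s (g x) h := by
  induction h using Nat.strong_induction_on with
  | _ h ih =>
    have hinfo := infoAt_ae_eq (G := G) (P := P) (g := g) (s := s) (s' := s') (h := h)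
      fun t ht => ih t ht (ht.trans hh)
    set δ : Fin N → Ω → ℝ := fun i x => play G s (g x) h i - play G s' (g x) h i with hδ
    have hδL : ∀ i, MemLp (δ i) 2 P := fun i => (hsL h hh i).sub (hsL' h hh i)
    have hzero : ∀ i, δ i =ᵐ[P] 0 := by
      refine ae_eq_zero_of_integral_system hδL (hG.lam_nonneg hh) (hG.lam_lt hh) fun i => ?_
      -- test both conditions with the difference of the two strategies
      have hfm : Measurable fun y => s h i y - s' h i y := (hsm h hh i).sub (hsm' h hh i)
      have hf : ∀ᵐ x ∂P, s h i (infoAt G s (g x) h i) - s' h i (infoAt G s (g x) h i) = δ i x := by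
        filter_upwards [hinfo i] with x hx
        rw [hδ]
        simp only [play_eq, hx]
      have hf' : ∀ᵐ x ∂P,
          s h i (infoAt G s' (g x) h i) - s' h i (infoAt G s' (g x) h i) = δ i x := by
        filter_upwards [hinfo i] with x hx
        rw [hδ]
        simp only [play_eq, hx]
      have e := hs h hh i _ hfm ((memLp_congr_ae hf).2 (hδL i))
      have e' := hs' h hh i _ hfm ((memLp_congr_ae hf').2 (hδL i))
      rw [integral_congr_ae (g := fun x => δ i x *
        marginalPayoff G h i (play G s (g x) h) (g x) (G.omegaBar h))
        (by filter_upwards [hf] with x hx; rw [hx])] at e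
      rw [integral_congr_ae (g := fun x => δ i x *
        marginalPayoff G h i (play G s' (g x) h) (g x) (G.omegaBar h))
        (by filter_upwards [hf'] with x hx; rw [hx])] at e'
      have hi := (hδL i).integrable_mul (hG.memLp_marginalPayoff (h := h)
        (u := fun γ => play G s γ h) (hsL h hh) i (G.omegaBar h))
      have hi' := (hδL i).integrable_mul (hG.memLp_marginalPayoff (h := h)
        (u := fun γ => play G s' γ h) (hsL' h hh) i (G.omegaBar h))
      have hsub := integral_sub hi' hi
      simp only [Pi.mul_apply] at hsub
      rw [e, e', sub_zero] at hsub
      rw [← hsub]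
      refine integral_congr_ae (ae_of_all _ fun x => ?_)
      simp only [hδ, marginalPayoff, Finset.sum_sub_distrib]
      ring
    have : ∀ᵐ x ∂P, ∀ i, δ i x = 0 := ae_all_iff.2 hzero
    filter_upwards [this] with x hx
    funext i
    exact (sub_eq_zero.1 (hx i)).symm

theorem IsBNE.play_ae_eq (hG : IsGaussianModel G P g ω) {s s' : Profile G}
    (hs : IsBNE G P g ω s) (hs' : IsBNE G P g ω s') {h : ℕ} (hh : h < G.H) :
    ∀ᵐ x ∂P, play G s' (g x) h = play G s (g x) h :=
  (hs.isStationary hG).play_ae_eq hG hs.measurable hs'.measurable hs.memLp hs'.memLp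
    (hs'.isStationary hG) hh

theorem IsBNE.infoAt_ae_eq (hG : IsGaussianModel G P g ω) {s s' : Profile G}
    (hs : IsBNE G P g ω s) (hs' : IsBNE G P g ω s') {h : ℕ} (hh : h < G.H) (i : Fin N) :
    ∀ᵐ x ∂P, infoAt G s' (g x) h i = infoAt G s (g x) h i :=
  DemandResponse.infoAt_ae_eq (fun _ ht => hs.play_ae_eq hG hs' (ht.trans hh)) i

theorem IsBNE.strategy_ae_eq (hG : IsGaussianModel G P g ω) {s s' : Profile G}
    (hs : IsBNE G P g ω s) (hs' : IsBNE G P g ω s') {h : ℕ} (hh : h < G.H) (i : Fin N) :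
    ∀ᵐ y ∂(P.map fun x => infoAt G s (g x) h i), s' h i y = s h i y := by
  have hI : Measurable fun x => infoAt G s (g x) h i :=
    (measurable_infoAt hs.measurable hh i).comp hG.measurable_pref
  rw [ae_map_iff hI.aemeasurable
    (measurableSet_eq_fun (hs'.measurable h hh i) (hs.measurable h hh i))]
  filter_upwards [hs.play_ae_eq hG hs' hh, hs.infoAt_ae_eq hG hs' hh i] with x hx hxi
  rw [← play_eq G s, ← hx, play_eq, hxi]

end Uniqueness

/-! ### Second moments of the augmented preferences -/

/-- The matrix `E[g̃ g̃ᵀ]` of the augmented preferences, in terms of the covariance and the mean. -/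
def secondMoment (G : EnergyGame N) : Matrix (Aug N) (Aug N) ℝ :=
  Matrix.fromBlocks (Matrix.of fun j k => G.cov j k + G.gBar ^ 2) (Matrix.of fun _ _ => G.gBar ^ 2)
    (Matrix.of fun _ _ => G.gBar ^ 2) (Matrix.of fun _ _ => G.gBar ^ 2)

namespace IsGaussianModel

variable {G : EnergyGame N} {P : Measure Ω} {g : Ω → Fin N → ℝ} {ω : ℕ → Ω → ℝ}

theorem measurable_augment (hG : IsGaussianModel G P g ω) :
    Measurable fun x => augment G (g x) := by
  refine measurable_pi_lambda _ fun a => ?_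
  cases a with
  | inl j => exact (measurable_pi_apply j).comp hG.measurable_pref
  | inr u => exact measurable_const

theorem cov_symm (hG : IsGaussianModel G P g ω) (i j : Fin N) : G.cov i j = G.cov j i := by
  rw [← hG.covariance, ← hG.covariance, covariance_comm]

variable [IsProbabilityMeasure P]

theorem memLp_augment (hG : IsGaussianModel G P g ω) (a : Aug N) :
    MemLp (fun x => augment G (g x) a) 2 P := by
  cases a with
  | inl j => exact hG.memLp_pref j
  | inr u => exact memLp_const _

theorem memLp_dotProduct_augment (hG : IsGaussianModel G P g ω) (y : Aug N → ℝ) :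
    MemLp (fun x => y ⬝ᵥ augment G (g x)) 2 P :=
  memLp_finsetSum _ fun a _ => (hG.memLp_augment a).const_mul (y a)

theorem integral_augment_mul_augment (hG : IsGaussianModel G P g ω) (a b : Aug N) :
    ∫ x, augment G (g x) a * augment G (g x) b ∂P = secondMoment G a b := by
  cases a with
  | inl i =>
    cases b with
    | inl j =>
      have h := covariance_eq_sub (hG.memLp_pref i) (hG.memLp_pref j)
      rw [hG.covariance, hG.mean, hG.mean] at h
      simp only [Pi.mul_apply] at h
      simp only [augment, secondMoment, Sum.elim_inl, fromBlocks_apply₁₁, of_apply]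
      rw [h]
      ring
    | inr u =>
      simp only [augment, secondMoment, Sum.elim_inl, Sum.elim_inr, fromBlocks_apply₁₂, of_apply]
      rw [integral_mul_const, hG.mean, sq]
  | inr u =>
    cases b with
    | inl j =>
      simp only [augment, secondMoment, Sum.elim_inl, Sum.elim_inr, fromBlocks_apply₂₁, of_apply]
      rw [integral_const_mul, hG.mean, sq]
    | inr u => simp [augment, secondMoment, sq]

theorem integral_dotProduct_augment_mul (hG : IsGaussianModel G P g ω) (y z : Aug N → ℝ) :
    ∫ x, (y ⬝ᵥ augment G (g x)) * (z ⬝ᵥ augment G (g x)) ∂P = y ⬝ᵥ secondMoment G *ᵥ z := by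
  have hint : ∀ a b, Integrable
      (fun x => (y a * augment G (g x) a) * (z b * augment G (g x) b)) P := fun a b =>
    integrable_fun_mul ((hG.memLp_augment a).const_mul _) ((hG.memLp_augment b).const_mul _)
  simp only [dotProduct, Finset.sum_mul_sum]
  rw [integral_finsetSum _ fun a _ => integrable_finsetSum _ fun b _ => hint a b]
  refine Finset.sum_congr rfl fun a _ => ?_
  rw [integral_finsetSum _ fun b _ => hint a b, mulVec, dotProduct, Finset.mul_sum]
  refine Finset.sum_congr rfl fun b _ => ?_
  rw [← hG.integral_augment_mul_augment, ← integral_mul_const, ← integral_const_mul]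
  refine integral_congr_ae (ae_of_all _ fun x => ?_)
  simp only
  ring

theorem secondMoment_posSemidef (hG : IsGaussianModel G P g ω) : (secondMoment G).PosSemidef := by
  refine .of_dotProduct_mulVec_nonneg ?_ fun y => ?_
  · ext a b
    simp only [conjTranspose_apply, star_trivial, ← hG.integral_augment_mul_augment, mul_comm]
  · rw [star_trivial, ← hG.integral_dotProduct_augment_mul]
    exact integral_nonneg fun x => mul_self_nonneg _

end IsGaussianModel

/-! ### The filter keeps an exact linear estimator -/

section Filter

variable {G : EnergyGame N} {P : Measure Ω} {g : Ω → Fin N → ℝ} {ω : ℕ → Ω → ℝ}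

theorem initialWeights_transpose_mulVec (i : Fin N) (y : Aug N → ℝ) :
    (initialWeights G i)ᵀ *ᵥ y =
      Sum.elim (Pi.single i (∑ j, G.cov i j / G.cov i i * y (Sum.inl j)))
        (fun _ => ∑ j, (1 - G.cov i j / G.cov i i) * y (Sum.inl j) + y (Sum.inr ())) := by
  funext a
  cases a with
  | inl k =>
    by_cases hk : k = i
    · subst hk; simp [initialWeights, mulVec, dotProduct, fromBlocks, transpose]
    · simp [initialWeights, mulVec, dotProduct, fromBlocks, transpose, hk]
  | inr u => simp [initialWeights, mulVec, dotProduct, fromBlocks, transpose]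

theorem initialWeights_transpose_fixed_own {i : Fin N} (hi : G.cov i i ≠ 0) :
    (initialWeights G i)ᵀ *ᵥ Pi.single (Sum.inl i) 1 = Pi.single (Sum.inl i) 1 := by
  rw [initialWeights_transpose_mulVec]
  funext a
  cases a with
  | inl k => by_cases hk : k = i <;> simp [Pi.single_apply, hk, hi]
  | inr u => simp [Pi.single_apply, hi]

theorem initialWeights_transpose_fixed_mean (i : Fin N) :
    (initialWeights G i)ᵀ *ᵥ Pi.single (Sum.inr ()) 1 = Pi.single (Sum.inr ()) 1 := by
  rw [initialWeights_transpose_mulVec]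
  funext a
  cases a with
  | inl k => by_cases hk : k = i <;> simp [hk]
  | inr u => simp

theorem isLinearEstimator_initial (hG : IsGaussianModel G P g ω) (i : Fin N) :
    IsLinearEstimator (secondMoment G) (initialWeights G i) (initialError G i) := by
  have hi : G.cov i i ≠ 0 := (hG.var_pos i).ne'
  refine ⟨?_, ?_, ?_, fun v hv => ?_⟩
  · rw [initialWeights, fromBlocks_multiply]
    congr 1
    · ext j k
      by_cases hk : k = i <;> simp [mul_apply, hk, hi]
    · ext j k
      simp [mul_apply, hi]
    · simp
    · simp
  · rw [Matrix.sub_mul, Matrix.one_mul, initialWeights, initialError, secondMoment,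
      fromBlocks_multiply]
    ext a b
    rcases a with j | u <;> rcases b with k | u'
    all_goals
      simp only [fromBlocks_apply₁₁, fromBlocks_apply₁₂, fromBlocks_apply₂₁, fromBlocks_apply₂₂,
        Matrix.sub_apply, Matrix.add_apply, Matrix.zero_mul, Matrix.one_mul, zero_add, Matrix.zero_apply,
        of_apply, mul_apply, ite_mul, zero_mul, Finset.sum_ite_eq', Finset.mem_univ, if_true,
        Fintype.sum_unique]
      ring
  · rw [initialError, fromBlocks_transpose]
    congr 1
    ext j k
    simp only [transpose_apply, of_apply]
    rw [hG.cov_symm k j, mul_comm]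
  · -- a combination of `g_i` and `ḡ` that vanishes in mean square is trivial
    rw [initialWeights_transpose_mulVec] at hv ⊢
    set p := ∑ j, G.cov i j / G.cov i i * v (Sum.inl j)
    set q := ∑ j, (1 - G.cov i j / G.cov i i) * v (Sum.inl j) + v (Sum.inr ())
    have h1 := congrFun hv (Sum.inr ())
    have h2 := congrFun hv (Sum.inl i)
    simp only [secondMoment, mulVec, dotProduct, Fintype.sum_sum_type, fromBlocks_apply₂₁,
      fromBlocks_apply₂₂, fromBlocks_apply₁₁, fromBlocks_apply₁₂, of_apply, Sum.elim_inl,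
      Sum.elim_inr, Pi.single_apply, mul_ite, mul_zero, Finset.sum_ite_eq', Finset.mem_univ,
      if_true, Fintype.sum_unique, Pi.zero_apply] at h1 h2
    have hp : p = 0 := by
      have : G.cov i i * p = 0 := by linarith
      exact (mul_eq_zero.1 this).resolve_left hi
    have hq : q = 0 := by
      rw [hp, mul_zero, zero_add] at h1
      exact (mul_eq_zero.1 h1).resolve_left (pow_ne_zero 2 hG.gBar_pos.ne')
    rw [hp, hq, Pi.single_zero]
    funext a
    cases a <;> rfl

/-- The state of the filter in one slot, for all users: exact linear estimators which reproduce the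
own preference and the mean. -/
structure IsFilterState (G : EnergyGame N) (T M : Fin N → Matrix (Aug N) (Aug N) ℝ) : Prop where
  estimator : ∀ i, IsLinearEstimator (secondMoment G) (T i) (M i)
  fixed_own : ∀ i, (T i)ᵀ *ᵥ Pi.single (Sum.inl i) 1 = Pi.single (Sum.inl i) 1
  fixed_mean : ∀ i, (T i)ᵀ *ᵥ Pi.single (Sum.inr ()) 1 = Pi.single (Sum.inr ()) 1

theorem rho_mul_lam_nonneg (hG : IsGaussianModel G P g ω) {h : ℕ} (hh : h < G.H) :
    0 ≤ rho G h * lam G h :=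
  mul_nonneg (inv_nonneg.2 (by linarith [hG.curvature_pos hh])) (hG.lam_nonneg hh)

theorem rho_mul_lam_lt_one (hG : IsGaussianModel G P g ω) {h : ℕ} (hh : h < G.H) :
    rho G h * lam G h < 1 := by
  have := hG.curvature_pos hh
  rw [rho, inv_mul_lt_one₀ (by linarith)]
  exact hG.lam_lt hh

theorem isFilterState_initial (hG : IsGaussianModel G P g ω) :
    IsFilterState G (initialWeights G) (initialError G) :=
  ⟨isLinearEstimator_initial hG, fun i => initialWeights_transpose_fixed_own (hG.var_pos i).ne',
    initialWeights_transpose_fixed_mean⟩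

variable [IsProbabilityMeasure P]

theorem secondMoment_transpose (hG : IsGaussianModel G P g ω) :
    (secondMoment G)ᵀ = secondMoment G := by
  simpa [IsHermitian] using hG.secondMoment_posSemidef.isHermitian

theorem IsFilterState.step (hG : IsGaussianModel G P g ω)
    {T M : Fin N → Matrix (Aug N) (Aug N) ℝ} (h : IsFilterState G T M)
    {A : (i : Fin N) → Matrix (Aug N) (ObsIndex G.info i) ℝ}
    {B : (i : Fin N) → Matrix (ObsIndex G.info i) (ObsIndex G.info i) ℝ}
    (hB : ∀ i, IsMoorePenrose ((A i)ᵀ * M i * A i) (B i)) :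
    IsFilterState G (fun i => T i + M i * A i * B i * ((A i)ᵀ - (A i)ᵀ * T i))
      (fun i => M i - M i * A i * B i * (A i)ᵀ * M i) where
  estimator i := (h.estimator i).update hG.secondMoment_posSemidef (hB i)
  fixed_own i := (h.estimator i).update_fixed hG.secondMoment_posSemidef (h.fixed_own i)
  fixed_mean i := (h.estimator i).update_fixed hG.secondMoment_posSemidef (h.fixed_mean i)

variable {R : FilterRun G}

theorem IsFilterRun.exists_step (hR : IsFilterRun G R) {h : ℕ} (hh : h + 1 < G.H) :
    ∃ B : (i : Fin N) → Matrix (ObsIndex G.info i) (ObsIndex G.info i) ℝ,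
      (∀ i, IsMoorePenrose ((obsMatrix G R h i)ᵀ * R.M h i * obsMatrix G R h i) (B i)) ∧
      (R.T (h + 1) = fun i => R.T h i + R.M h i * obsMatrix G R h i * B i *
        ((obsMatrix G R h i)ᵀ - (obsMatrix G R h i)ᵀ * R.T h i)) ∧
      R.M (h + 1) = fun i => R.M h i - R.M h i * obsMatrix G R h i * B i *
        (obsMatrix G R h i)ᵀ * R.M h i := by
  choose B hB hK using hR.gain h ((Nat.lt_succ_self h).trans hh)
  refine ⟨B, hB, ?_, ?_⟩ <;> funext i
  · rw [hR.weights_step h hh, hK]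
  · rw [hR.error_step h hh, hK]

theorem IsFilterRun.isFilterState (hG : IsGaussianModel G P g ω) (hR : IsFilterRun G R) {h : ℕ}
    (hh : h < G.H) : IsFilterState G (R.T h) (R.M h) := by
  induction h with
  | zero =>
    rw [funext hR.weights_init, funext hR.error_init]
    exact isFilterState_initial hG
  | succ h ih =>
    obtain ⟨B, hB, hT, hM⟩ := hR.exists_step hh
    rw [hT, hM]
    exact (ih ((Nat.lt_succ_self h).trans hh)).step hG hB

/-- The estimation error is uncorrelated with all past observations. -/
theorem IsFilterRun.error_mul_obsMatrix (hG : IsGaussianModel G P g ω) (hR : IsFilterRun G R)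
    {h t : ℕ} (hh : h < G.H) (ht : t < h) (i : Fin N) : R.M h i * obsMatrix G R t i = 0 := by
  induction h with
  | zero => exact absurd ht (Nat.not_lt_zero t)
  | succ h ih =>
    have hh' := (Nat.lt_succ_self h).trans hh
    obtain ⟨B, hB, -, hM⟩ := hR.exists_step hh
    simp only [hM]
    rcases (Nat.lt_succ_iff_lt_or_eq.1 ht) with ht | rfl
    · rw [Matrix.sub_mul, Matrix.mul_assoc _ (R.M h i), ih hh' ht, Matrix.mul_zero, sub_zero]
    · exact ((hR.isFilterState hG hh').estimator i).update_error_mul_obs _ _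
        hG.secondMoment_posSemidef (hB i)

/-! ### Existence of a run of the filter -/

/-- The coefficients `v` solve the linear equilibrium system of slot `h` for the weights `T`. -/
def SolvesLinearSystem (G : EnergyGame N) (h : ℕ) (T : Fin N → Matrix (Aug N) (Aug N) ℝ)
    (v : Fin N → Aug N → ℝ) : Prop :=
  ∀ i, (T i)ᵀ *ᵥ v i + (rho G h * lam G h) •
    ∑ j ∈ Finset.univ.erase i, (T i)ᵀ *ᵥ ((T j)ᵀ *ᵥ v j) = rho G h • Pi.single (Sum.inl i) 1

theorem IsFilterState.exists_solvesLinearSystem (hG : IsGaussianModel G P g ω) {h : ℕ}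
    (hh : h < G.H) {T M : Fin N → Matrix (Aug N) (Aug N) ℝ} (hT : IsFilterState G T M) :
    ∃ v, SolvesLinearSystem G h T v := by
  obtain ⟨w, hw⟩ := exists_estimator_system_solution hG.secondMoment_posSemidef hT.estimator
    (rho_mul_lam_nonneg hG hh) (rho_mul_lam_lt_one hG hh)
    (fun i => rho G h • Pi.single (Sum.inl i) 1)
    (fun i => by rw [mulVec_smul, hT.fixed_own])
  -- the solution lies in the ranges of the `Tᵢᵀ`, so it serves as its own preimage
  refine ⟨w, fun i => ?_⟩
  rw [(hw i).1, ← (hw i).2]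
  simp only [fun j => (hw j).1]

/-- The equilibrium coefficients chosen in slot `h` for the weights `T`. -/
def chosenCoeff (G : EnergyGame N) (h : ℕ) (T : Fin N → Matrix (Aug N) (Aug N) ℝ) :
    Fin N → Aug N → ℝ :=
  Classical.epsilon (SolvesLinearSystem G h T)

/-- The observation matrix that belongs to the chosen coefficients. -/
def chosenObs (G : EnergyGame N) (h : ℕ) (T : Fin N → Matrix (Aug N) (Aug N) ℝ) (i : Fin N) :
    Matrix (Aug N) (ObsIndex G.info i) ℝ :=
  Matrix.of fun a o => observe G.info i (fun j => ((T j)ᵀ *ᵥ chosenCoeff G h T j) a) o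

/-- The pseudoinverse of the innovation covariance for the chosen coefficients. -/
def chosenPinv (G : EnergyGame N) (h : ℕ) (T M : Fin N → Matrix (Aug N) (Aug N) ℝ) (i : Fin N) :
    Matrix (ObsIndex G.info i) (ObsIndex G.info i) ℝ :=
  Classical.epsilon (IsMoorePenrose ((chosenObs G h T i)ᵀ * M i * chosenObs G h T i))

/-- Weights and error covariances of the filter with the chosen coefficients. -/
def chosenState (G : EnergyGame N) :
    ℕ → (Fin N → Matrix (Aug N) (Aug N) ℝ) × (Fin N → Matrix (Aug N) (Aug N) ℝ)
  | 0 => (initialWeights G, initialError G)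
  | h + 1 =>
    let T := (chosenState G h).1
    let M := (chosenState G h).2
    let A := chosenObs G h T
    let B := chosenPinv G h T M
    (fun i => T i + M i * A i * B i * ((A i)ᵀ - (A i)ᵀ * T i),
      fun i => M i - M i * A i * B i * (A i)ᵀ * M i)

theorem chosenPinv_isMoorePenrose {h : ℕ} {T M : Fin N → Matrix (Aug N) (Aug N) ℝ}
    (hT : IsFilterState G T M) (i : Fin N) :
    IsMoorePenrose ((chosenObs G h T i)ᵀ * M i * chosenObs G h T i) (chosenPinv G h T M i) :=
  Classical.epsilon_spec (exists_isMoorePenrose_of_isSymm (by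
    simp only [transpose_mul, transpose_transpose, (hT.estimator i).symm, Matrix.mul_assoc]))

theorem chosenState_isFilterState (hG : IsGaussianModel G P g ω) (h : ℕ) :
    IsFilterState G (chosenState G h).1 (chosenState G h).2 := by
  induction h with
  | zero => exact isFilterState_initial hG
  | succ h ih => exact ih.step hG (chosenPinv_isMoorePenrose ih)

/-- The run of the filter with the chosen coefficients; the constant terms are the same for all
users. -/
def chosenRun (G : EnergyGame N) : FilterRun G where
  T h := (chosenState G h).1
  M h := (chosenState G h).2
  K h i := (chosenState G h).2 i * chosenObs G h (chosenState G h).1 i *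
    chosenPinv G h (chosenState G h).1 (chosenState G h).2 i
  v h := chosenCoeff G h (chosenState G h).1
  r h _ := -(rho G h * mu G h * G.omegaBar h) / (1 + rho G h * lam G h * (N - 1))

theorem chosenRun_isFilterRun (hG : IsGaussianModel G P g ω) : IsFilterRun G (chosenRun G) where
  weights_init _ := rfl
  error_init _ := rfl
  linear_system _ hh :=
    Classical.epsilon_spec ((chosenState_isFilterState hG _).exists_solvesLinearSystem hG hh)
  constant_system h hh i := by
    have hN : (1 : ℝ) ≤ N := by exact_mod_cast (Fin.pos i)
    have hc := mul_nonneg (rho_mul_lam_nonneg hG hh) (sub_nonneg.2 hN)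
    have hcard : ((Finset.univ.erase i).card : ℝ) = N - 1 := by
      rw [Finset.card_erase_of_mem (Finset.mem_univ i), Finset.card_univ, Fintype.card_fin,
        Nat.cast_sub (Fin.pos i), Nat.cast_one]
    simp only [chosenRun, Finset.sum_const, nsmul_eq_mul, hcard]
    field_simp
    ring
  gain _ _ i := ⟨_, chosenPinv_isMoorePenrose (chosenState_isFilterState hG _) i, rfl⟩
  weights_step _ _ _ := rfl
  error_step _ _ _ := rfl

end Filter

/-! ### Estimation errors are independent of the information -/

namespace IsGaussianModel

variable {G : EnergyGame N} {P : Measure Ω} {g : Ω → Fin N → ℝ} {ω : ℕ → Ω → ℝ}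

theorem hasGaussianLaw_augment (hG : IsGaussianModel G P g ω) :
    HasGaussianLaw (fun x => augment G (g x)) P := by
  let L : (Fin N → ℝ) →L[ℝ] (Aug N → ℝ) :=
    ContinuousLinearMap.pi (Sum.elim (fun j => ContinuousLinearMap.proj j) fun _ => 0)
  have hL := (hG.gaussian.map_fun L).isGaussian_map
  have hLm : Measurable fun x => L (g x) := L.measurable.comp hG.measurable_pref
  refine ⟨?_⟩
  have : (fun x => augment G (g x)) =
      (fun y => y + Sum.elim (fun _ => 0) fun _ => G.gBar) ∘ fun x => L (g x) := by
    funext x a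
    cases a <;> simp [augment, L]
  rw [this, ← Measure.map_map (by fun_prop) hLm]
  infer_instance

theorem measurable_mulVec_augment (hG : IsGaussianModel G P g ω) (A : Matrix (Aug N) (Aug N) ℝ) :
    Measurable fun x => A *ᵥ augment G (g x) := by
  have hA : Measurable (A *ᵥ ·) := A.mulVecLin.continuous_of_finiteDimensional.measurable
  exact hA.comp hG.measurable_augment

variable [IsProbabilityMeasure P]

section Residual

variable {T M : Matrix (Aug N) (Aug N) ℝ}

theorem integral_residual_mul (hG : IsGaussianModel G P g ω)
    (h : IsLinearEstimator (secondMoment G) T M) (a : Aug N) (y : Aug N → ℝ) :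
    ∫ x, ((1 - T) *ᵥ augment G (g x)) a * (y ⬝ᵥ augment G (g x)) ∂P = (M *ᵥ y) a := by
  have := hG.integral_dotProduct_augment_mul ((1 - T) a) y
  rw [h.error, ← mulVec_mulVec]
  exact this

theorem memLp_residual (hG : IsGaussianModel G P g ω) (a : Aug N) :
    MemLp (fun x => ((1 - T) *ᵥ augment G (g x)) a) 2 P :=
  hG.memLp_dotProduct_augment _

/-- The mean `ḡ` is itself a coordinate of the augmented preferences, so an error that is
uncorrelated with it is centred. -/
theorem integral_residual (hG : IsGaussianModel G P g ω)
    (h : IsLinearEstimator (secondMoment G) T M)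
    (hT : Tᵀ *ᵥ Pi.single (Sum.inr ()) 1 = Pi.single (Sum.inr ()) 1) (a : Aug N) :
    ∫ x, ((1 - T) *ᵥ augment G (g x)) a ∂P = 0 := by
  have h0 := hG.integral_residual_mul h a (Pi.single (Sum.inr ()) 1)
  rw [h.error_mulVec_eq_zero (secondMoment_transpose hG) hT] at h0
  simp only [single_one_dotProduct, Pi.zero_apply] at h0
  simp only [augment, Sum.elim_inr] at h0
  rw [integral_mul_const] at h0
  exact (mul_eq_zero.1 h0).resolve_right hG.gBar_pos.ne'

theorem indepFun_residual (hG : IsGaussianModel G P g ω)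
    (h : IsLinearEstimator (secondMoment G) T M)
    (hT : Tᵀ *ᵥ Pi.single (Sum.inr ()) 1 = Pi.single (Sum.inr ()) 1)
    {κ : Type*} [Fintype κ] {y : κ → Aug N → ℝ} (hy : ∀ k, M *ᵥ y k = 0) :
    IndepFun (fun x => (1 - T) *ᵥ augment G (g x)) (fun x k => y k ⬝ᵥ augment G (g x)) P := by
  refine HasGaussianLaw.indepFun_of_covariance_eval
    (X := fun a x => ((1 - T) *ᵥ augment G (g x)) a) (Y := fun k x => y k ⬝ᵥ augment G (g x))
    ?_ fun a k => ?_
  · let L : (Aug N → ℝ) →L[ℝ] (Aug N → ℝ) × (κ → ℝ) :=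
      LinearMap.toContinuousLinearMap ((mulVecLin (1 - T)).prod (mulVecLin (Matrix.of y)))
    exact hG.hasGaussianLaw_augment.map_fun L
  · rw [covariance_eq_sub (hG.memLp_residual a) (hG.memLp_dotProduct_augment _),
      hG.integral_residual h hT, zero_mul, sub_zero]
    exact (hG.integral_residual_mul h a _).trans (by rw [hy]; rfl)

theorem integral_residual_mul_residual (hG : IsGaussianModel G P g ω)
    (h : IsLinearEstimator (secondMoment G) T M) (a b : Aug N) :
    ∫ x, ((1 - T) *ᵥ augment G (g x)) a * ((1 - T) *ᵥ augment G (g x)) b ∂P = M a b := by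
  have h1 := hG.integral_residual_mul h a ((1 - T) b)
  have h2 : (M *ᵥ (1 - T) b) a = (M * (1 - T)ᵀ : Matrix _ _ ℝ) a b := rfl
  rw [h2, h.error, Matrix.mul_assoc, ← h.error_eq (secondMoment_transpose hG),
    h.sub_mul_error] at h1
  exact h1

end Residual

end IsGaussianModel

/-! ### The strategies computed by the filter -/

section FilterProfile

variable {G : EnergyGame N}

/-- The estimate of the augmented preferences that user `i` computes from its information with the
Kalman recursion of the run `R`. -/
def estimate (R : FilterRun G) : (h : ℕ) → (i : Fin N) → Info G h i → Aug N → ℝ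
  | 0, i, y => R.T 0 i *ᵥ augment G fun _ => y.1
  | h + 1, i, y =>
    let e := estimate R h i (y.1, fun t => y.2 t.castSucc)
    e + R.K h i *ᵥ fun o =>
      y.2 (Fin.last h) o - observe G.info i (R.r h) o - ((obsMatrix G R h i)ᵀ *ᵥ e) o

/-- The linear strategies given by the coefficients of the run `R`. -/
def filterProfile (R : FilterRun G) : Profile G :=
  fun h i y => R.v h i ⬝ᵥ estimate R h i y + R.r h i

theorem measurable_estimate (R : FilterRun G) (h : ℕ) (i : Fin N) :
    Measurable (estimate R h i) := by
  induction h with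
  | zero =>
    refine measurable_pi_lambda _ fun a => ?_
    simp only [estimate, mulVec, dotProduct]
    refine Finset.measurable_sum _ fun b _ => Measurable.const_mul ?_ _
    cases b with
    | inl j => exact measurable_fst
    | inr u => exact measurable_const
  | succ h ih =>
    have he : Measurable fun y : Info G (h + 1) i =>
        estimate R h i (y.1, fun t => y.2 t.castSucc) := ih.comp (by fun_prop)
    refine measurable_pi_lambda _ fun a => ?_
    have hea : ∀ b, Measurable fun y : Info G (h + 1) i =>
        estimate R h i (y.1, fun t => y.2 t.castSucc) b := fun b => (measurable_pi_apply b).comp he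
    simp only [estimate, mulVec, dotProduct, Pi.add_apply]
    fun_prop

theorem measurable_filterProfile (R : FilterRun G) (h : ℕ) (i : Fin N) :
    Measurable (filterProfile R h i) := by
  have hea : ∀ b, Measurable fun y : Info G h i => estimate R h i y b := fun b =>
    (measurable_pi_apply b).comp (measurable_estimate R h i)
  unfold filterProfile dotProduct
  fun_prop

theorem observe_affine (m : InfoModel N) (i : Fin N) {A : Type*} [Fintype A] (w : Fin N → A → ℝ)
    (x : A → ℝ) (r : Fin N → ℝ) (o : ObsIndex m i) :
    observe m i (fun j => w j ⬝ᵥ x + r j) o =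
      (fun a => observe m i (fun j => w j a) o) ⬝ᵥ x + observe m i r o := by
  cases m with
  | priv => exact nomatch (o : Empty)
  | share E => rfl
  | broadcast =>
    simp only [observe, Finset.sum_add_distrib, dotProduct, Finset.sum_mul]
    rw [Finset.sum_comm]

theorem observe_eq_obsMatrix (R : FilterRun G) (h : ℕ) (i : Fin N) (x : Aug N → ℝ)
    (o : ObsIndex G.info i) :
    observe G.info i (fun j => ((R.T h j)ᵀ *ᵥ R.v h j) ⬝ᵥ x + R.r h j) o =
      (obsMatrix G R h i)ᵀ o ⬝ᵥ x + observe G.info i (R.r h) o :=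
  observe_affine _ _ _ _ _ _

theorem initialWeights_mulVec_augment (i : Fin N) (γ : Fin N → ℝ) :
    initialWeights G i *ᵥ augment G (fun _ => γ i) = initialWeights G i *ᵥ augment G γ := by
  funext a
  cases a <;> simp [initialWeights, augment, mulVec, dotProduct]

variable {R : FilterRun G}

theorem play_filterProfile_of_estimate {γ : Fin N → ℝ} {h : ℕ} {i : Fin N}
    (he : estimate R h i (infoAt G (filterProfile R) γ h i) = R.T h i *ᵥ augment G γ) :
    play G (filterProfile R) γ h i = ((R.T h i)ᵀ *ᵥ R.v h i) ⬝ᵥ augment G γ + R.r h i := by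
  rw [play_eq, filterProfile, he, dotProduct_mulVec, mulVec_transpose]

theorem estimate_infoAt (hR : IsFilterRun G R) (γ : Fin N → ℝ) {h : ℕ} (hh : h < G.H) (i : Fin N) :
    estimate R h i (infoAt G (filterProfile R) γ h i) = R.T h i *ᵥ augment G γ := by
  induction h generalizing i with
  | zero =>
    simp only [estimate, infoAt, hR.weights_init]
    exact initialWeights_mulVec_augment i γ
  | succ h ih =>
    have hh' := (Nat.lt_succ_self h).trans hh
    have hplay : play G (filterProfile R) γ h =
        fun j => ((R.T h j)ᵀ *ᵥ R.v h j) ⬝ᵥ augment G γ + R.r h j :=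
      funext fun j => play_filterProfile_of_estimate (ih hh' j)
    have hprev : estimate R h i ((infoAt G (filterProfile R) γ (h + 1) i).1,
        fun t => (infoAt G (filterProfile R) γ (h + 1) i).2 t.castSucc) =
        R.T h i *ᵥ augment G γ := ih hh' i
    have hobs : ∀ o, (infoAt G (filterProfile R) γ (h + 1) i).2 (Fin.last h) o =
        (obsMatrix G R h i)ᵀ o ⬝ᵥ augment G γ + observe G.info i (R.r h) o := fun o => by
      rw [← observe_eq_obsMatrix, ← hplay]
      rfl
    simp only [estimate, hprev, hobs, hR.weights_step h hh i, add_mulVec, ← mulVec_mulVec,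
      sub_mulVec]
    congr 2
    funext o
    simp only [add_sub_cancel_right, Pi.sub_apply]
    rfl

theorem play_filterProfile (hR : IsFilterRun G R) (γ : Fin N → ℝ) {h : ℕ} (hh : h < G.H)
    (i : Fin N) :
    play G (filterProfile R) γ h i = ((R.T h i)ᵀ *ᵥ R.v h i) ⬝ᵥ augment G γ + R.r h i :=
  play_filterProfile_of_estimate (estimate_infoAt hR γ hh i)

/-- Linear forms in the augmented preferences which generate the information of user `i`: the own
preference, and the past observations up to constants. -/
def infoForm (R : FilterRun G) (h : ℕ) (i : Fin N) :
    Option (Fin h × ObsIndex G.info i) → Aug N → ℝ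
  | none => Pi.single (Sum.inl i) 1
  | some (t, o) => (obsMatrix G R t i)ᵀ o

theorem infoAt_filterProfile (hR : IsFilterRun G R) (γ : Fin N → ℝ) {h : ℕ} (hh : h < G.H)
    (i : Fin N) :
    infoAt G (filterProfile R) γ h i =
      (infoForm R h i none ⬝ᵥ augment G γ, fun t o =>
        infoForm R h i (some (t, o)) ⬝ᵥ augment G γ + observe G.info i (R.r t) o) := by
  refine Prod.ext ?_ ?_
  · simp [infoAt, infoForm, augment]
  · funext t o
    simp only [infoAt, infoForm]
    rw [← observe_eq_obsMatrix, ← funext fun j => play_filterProfile hR γ (t.2.trans hh) j]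

/-- The linear system makes the marginal payoff a linear form in the estimation error. -/
theorem marginalPayoff_filterProfile (hR : IsFilterRun G R) (γ : Fin N → ℝ) {h : ℕ} (hh : h < G.H)
    (i : Fin N) (hc : 0 < tau G h + G.alpha h) :
    marginalPayoff G h i (play G (filterProfile R) γ h) γ (G.omegaBar h) =
      (-lam G h • ∑ j ∈ Finset.univ.erase i, (R.T h j)ᵀ *ᵥ R.v h j) ⬝ᵥ
        ((1 - R.T h i) *ᵥ augment G γ) := by
  have hρ : 2 * (tau G h + G.alpha h) * rho G h = 1 := mul_inv_cancel₀ (by linarith)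
  have h1 := congrArg (· ⬝ᵥ augment G γ) (hR.linear_system h hh i)
  have h2 := hR.constant_system h hh i
  simp only [add_dotProduct, smul_dotProduct, smul_eq_mul, single_one_dotProduct] at h1
  have htr : ∀ y : Aug N → ℝ, (R.T h i)ᵀ *ᵥ y ⬝ᵥ augment G γ = y ⬝ᵥ R.T h i *ᵥ augment G γ :=
    fun y => by rw [mulVec_transpose, dotProduct_mulVec]
  rw [← mulVec_sum, htr, htr] at h1
  simp only [marginalPayoff, play_filterProfile hR γ hh, Finset.sum_add_distrib]
  rw [htr, ← sum_dotProduct, smul_dotProduct, sub_mulVec, one_mulVec, dotProduct_sub, smul_eq_mul]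
  have h3 : augment G γ (Sum.inl i) = γ i := rfl
  rw [h3] at h1
  set W := ∑ j ∈ Finset.univ.erase i, (R.T h j)ᵀ *ᵥ R.v h j
  set r := ∑ j ∈ Finset.univ.erase i, R.r h j
  linear_combination (-2 * (tau G h + G.alpha h)) * h1 + (-2 * (tau G h + G.alpha h)) * h2
    + (lam G h * (W ⬝ᵥ R.T h i *ᵥ augment G γ) - γ i + lam G h * r
      + mu G h * G.omegaBar h) * hρ

end FilterProfile

/-! ### The filter strategies form an equilibrium -/

section Verification

variable {G : EnergyGame N} {P : Measure Ω} {g : Ω → Fin N → ℝ} {ω : ℕ → Ω → ℝ}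
  [IsProbabilityMeasure P] {R : FilterRun G}

theorem memLp_play_filterProfile (hG : IsGaussianModel G P g ω) (hR : IsFilterRun G R) {h : ℕ}
    (hh : h < G.H) (i : Fin N) : MemLp (fun x => play G (filterProfile R) (g x) h i) 2 P := by
  simp only [play_filterProfile hR _ hh]
  exact (hG.memLp_dotProduct_augment _).add (memLp_const _)

theorem indepFun_residual_infoAt (hG : IsGaussianModel G P g ω) (hR : IsFilterRun G R) {h : ℕ}
    (hh : h < G.H) (i : Fin N) :
    IndepFun (fun x => (1 - R.T h i) *ᵥ augment G (g x))
      (fun x => infoAt G (filterProfile R) (g x) h i) P := by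
  have hS := hR.isFilterState hG hh
  have hy : ∀ k, R.M h i *ᵥ infoForm R h i k = 0 := by
    rintro (_ | ⟨t, o⟩)
    · exact (hS.estimator i).error_mulVec_eq_zero (secondMoment_transpose hG) (hS.fixed_own i)
    · funext a
      exact congrFun (congrFun (hR.error_mul_obsMatrix hG hh t.2 i) a) o
  have hind := hG.indepFun_residual (hS.estimator i) (hS.fixed_mean i) hy
  have hΦ : Measurable fun F : Option (Fin h × ObsIndex G.info i) → ℝ =>
      ((F none, fun t o => F (some (t, o)) + observe G.info i (R.r t) o) : Info G h i) := by
    fun_prop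
  have := hind.comp measurable_id hΦ
  refine this.congr (ae_of_all _ fun x => rfl) (ae_of_all _ fun x => ?_)
  simp only [infoAt_filterProfile hR _ hh i, Function.comp_apply]

theorem isStationary_filterProfile (hG : IsGaussianModel G P g ω) (hR : IsFilterRun G R) :
    IsStationary G P g (filterProfile R) := by
  intro h hh i f hf _
  have hS := hR.isFilterState hG hh
  simp only [marginalPayoff_filterProfile hR _ hh i (hG.curvature_pos hh)]
  set z := -lam G h • ∑ j ∈ Finset.univ.erase i, (R.T h j)ᵀ *ᵥ R.v h j
  have hz : Measurable fun e : Aug N → ℝ => z ⬝ᵥ e := by unfold dotProduct; fun_prop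
  have hI : Measurable fun x => infoAt G (filterProfile R) (g x) h i :=
    (measurable_infoAt (fun h _ i => measurable_filterProfile R h i) hh i).comp hG.measurable_pref
  have hE : Measurable fun x => (1 - R.T h i) *ᵥ augment G (g x) :=
    hG.measurable_mulVec_augment _
  rw [(indepFun_residual_infoAt hG hR hh i).symm.integral_fun_comp_mul_comp (f := f)
    (g := fun e => z ⬝ᵥ e) hI.aemeasurable hE.aemeasurable hf.aestronglyMeasurable
    hz.aestronglyMeasurable]
  have : ∫ x, z ⬝ᵥ ((1 - R.T h i) *ᵥ augment G (g x)) ∂P = 0 := by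
    simp only [dotProduct]
    rw [integral_finsetSum _ fun a _ =>
      ((hG.memLp_residual a).integrable (by norm_num)).const_mul _]
    refine Finset.sum_eq_zero fun a _ => ?_
    rw [integral_const_mul]
    exact mul_eq_zero_of_right _ (hG.integral_residual (hS.estimator i) (hS.fixed_mean i) a)
  rw [this, mul_zero]

theorem isBNE_filterProfile (hG : IsGaussianModel G P g ω) (hR : IsFilterRun G R) :
    IsBNE G P g ω (filterProfile R) :=
  (isStationary_filterProfile hG hR).isBNE hG (fun h _ i => measurable_filterProfile R h i)
    fun _ hh i => memLp_play_filterProfile hG hR hh i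

/-! ### Posterior means -/

theorem posteriorMean_filterProfile (hG : IsGaussianModel G P g ω) (hR : IsFilterRun G R) {h : ℕ}
    (hh : h < G.H) (i : Fin N) (a : Aug N) :
    P[fun y => augment G (g y) a | infoSigma G (filterProfile R) g h i] =ᵐ[P]
      fun x => (R.T h i *ᵥ augment G (g x)) a := by
  have hS := hR.isFilterState hG hh
  have hm : ∀ h < G.H, ∀ i, Measurable (filterProfile R h i) := fun h _ i =>
    measurable_filterProfile R h i
  have hle := infoSigma_le hG.measurable_pref hm hh i
  have hE : Measurable fun x => (1 - R.T h i) *ᵥ augment G (g x) :=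
    hG.measurable_mulVec_augment _
  have hsplit : (fun y => augment G (g y) a) = (fun y => (R.T h i *ᵥ augment G (g y)) a)
      + fun y => ((1 - R.T h i) *ᵥ augment G (g y)) a := by
    funext y
    simp [sub_mulVec]
  have hTint : Integrable (fun y => (R.T h i *ᵥ augment G (g y)) a) P :=
    (hG.memLp_dotProduct_augment _).integrable (by norm_num)
  have hTm : StronglyMeasurable[infoSigma G (filterProfile R) g h i]
      fun y => (R.T h i *ᵥ augment G (g y)) a := by
    refine Measurable.stronglyMeasurable ?_
    simp only [← estimate_infoAt hR _ hh i]
    exact ((measurable_pi_apply a).comp (measurable_estimate R h i)).comp (comap_measurable _)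
  have hEm : StronglyMeasurable[MeasurableSpace.comap
      (fun x => (1 - R.T h i) *ᵥ augment G (g x)) inferInstance]
      fun y => ((1 - R.T h i) *ᵥ augment G (g y)) a := by
    refine Measurable.stronglyMeasurable ?_
    exact (measurable_pi_apply a).comp
      (comap_measurable fun x => (1 - R.T h i) *ᵥ augment G (g x))
  have hindep := condExp_indep_eq hE.comap_le hle hEm
    ((IndepFun_iff_Indep _ _ _).1 (indepFun_residual_infoAt hG hR hh i))
  rw [hsplit]
  have hadd := condExp_add hTint ((hG.memLp_residual (T := R.T h i) a).integrable (by norm_num))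
    (infoSigma G (filterProfile R) g h i)
  rw [condExp_of_stronglyMeasurable hle hTm hTint] at hadd
  filter_upwards [hadd, hindep] with x hx hx'
  rw [hx, Pi.add_apply, hx', hG.integral_residual (hS.estimator i) (hS.fixed_mean i), add_zero]

/-- Conditioning on almost surely equal random variables gives the same conditional expectation,
although the generated σ-algebras may differ. -/
theorem condExp_comap_congr {β : Type*} [MeasurableSpace β] {X X' : Ω → β} (hX : Measurable X)
    (hX' : Measurable X') (h : X =ᵐ[P] X') {f : Ω → ℝ} (hf : Integrable f P) :
    P[f | MeasurableSpace.comap X inferInstance] =ᵐ[P]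
      P[f | MeasurableSpace.comap X' inferInstance] := by
  refine ae_eq_condExp_of_forall_setIntegral_eq hX'.comap_le hf
    (fun _ _ _ => integrable_condExp.integrableOn) ?_ ?_
  · rintro _ ⟨C, hC, rfl⟩ -
    have hset : X' ⁻¹' C =ᵐ[P] X ⁻¹' C := by
      filter_upwards [h] with x hx
      exact propext (show X' x ∈ C ↔ X x ∈ C by rw [hx])
    rw [setIntegral_congr_set hset, setIntegral_congr_set hset,
      setIntegral_condExp hX.comap_le hf ⟨C, hC, rfl⟩]
  · obtain ⟨φ, hφ, hφX⟩ := (stronglyMeasurable_condExp (μ := P) (f := f)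
      (m := MeasurableSpace.comap X inferInstance)).measurable.exists_eq_measurable_comp
    refine ⟨φ ∘ X', (hφ.comp (comap_measurable X')).stronglyMeasurable, ?_⟩
    rw [hφX]
    filter_upwards [h] with x hx
    simp only [Function.comp_apply, hx]

theorem IsBNE.posteriorMean_ae_eq (hG : IsGaussianModel G P g ω) {s : Profile G}
    (hs : IsBNE G P g ω s) (hR : IsFilterRun G R) {h : ℕ} (hh : h < G.H) (i : Fin N) :
    ∀ᵐ x ∂P, posteriorMean G P g s h i x = R.T h i *ᵥ augment G (g x) := by
  have hb := isBNE_filterProfile hG hR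
  have hinfo := hb.infoAt_ae_eq hG hs hh i
  have ha : ∀ a, ∀ᵐ x ∂P, posteriorMean G P g s h i x a = (R.T h i *ᵥ augment G (g x)) a :=
    fun a => by
      have hc := condExp_comap_congr
        ((measurable_infoAt hs.measurable hh i).comp hG.measurable_pref)
        ((measurable_infoAt hb.measurable hh i).comp hG.measurable_pref) hinfo
        ((hG.memLp_augment a).integrable (by norm_num))
      exact hc.trans (posteriorMean_filterProfile hG hR hh i a)
  filter_upwards [ae_all_iff.2 ha] with x hx
  exact funext hx

theorem IsBNE.integral_posterior_error (hG : IsGaussianModel G P g ω) {s : Profile G}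
    (hs : IsBNE G P g ω s) (hR : IsFilterRun G R) {h : ℕ} (hh : h < G.H) (i : Fin N)
    (a b : Aug N) :
    ∫ x, (augment G (g x) a - posteriorMean G P g s h i x a) *
      (augment G (g x) b - posteriorMean G P g s h i x b) ∂P = R.M h i a b := by
  rw [← hG.integral_residual_mul_residual ((hR.isFilterState hG hh).estimator i) a b]
  refine integral_congr_ae ?_
  filter_upwards [hs.posteriorMean_ae_eq hG hR hh i] with x hx
  simp only [hx, sub_mulVec, one_mulVec, Pi.sub_apply]

theorem IsBNE.strategy_eq (hG : IsGaussianModel G P g ω) {s : Profile G}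
    (hs : IsBNE G P g ω s) (hR : IsFilterRun G R) {h : ℕ} (hh : h < G.H) (i : Fin N) :
    ∀ᵐ x ∂P, s h i (infoAt G s (g x) h i)
      = R.v h i ⬝ᵥ posteriorMean G P g s h i x + R.r h i := by
  filter_upwards [hs.posteriorMean_ae_eq hG hR hh i,
    (isBNE_filterProfile hG hR).play_ae_eq hG hs hh] with x hx hx'
  rw [← play_eq G s, hx', play_filterProfile hR _ hh, hx, dotProduct_mulVec, mulVec_transpose]

end Verification

end DemandResponse

end


theorem proposition1 {N : ℕ} (G : EnergyGame N)
    (hγ : ∀ h < G.H, 0 < G.gamma h) (hκ : ∀ h < G.H, 0 < G.kappa h)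
    (hα : ∀ h < G.H, 0 < G.alpha h) (hgBar : 0 < G.gBar)
    {Ω : Type*} [MeasurableSpace Ω] (P : Measure Ω) [IsProbabilityMeasure P]
    (g : Ω → Fin N → ℝ) (ω : ℕ → Ω → ℝ)
    -- the prior on the preferences is normal with mean `ḡ 1` and covariance matrix `G.cov`
    (hgm : Measurable g) (hg : HasGaussianLaw g P)
    (hmean : ∀ i, ∫ x, g x i ∂P = G.gBar)
    (hcov : ∀ i j, cov[fun x => g x i, fun x => g x j; P] = G.cov i j)
    (hvar : ∀ i, 0 < G.cov i i)
    -- the renewable terms have mean `ω̄_h` and are independent of the preferences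
    (hωint : ∀ h < G.H, Integrable (ω h) P)
    (hωmean : ∀ h < G.H, ∫ x, ω h x ∂P = G.omegaBar h)
    (hind : ∀ h < G.H, IndepFun g (ω h) P) :
    -- an equilibrium exists
    (∃ s : Profile G, IsBNE G P g ω s) ∧
    -- it is unique up to null sets, as a map of the information and in realized consumption
    (∀ s s' : Profile G, IsBNE G P g ω s → IsBNE G P g ω s' → ∀ h < G.H, ∀ i,
      (∀ᵐ y ∂(P.map fun x => infoAt G s (g x) h i), s' h i y = s h i y) ∧
      (∀ᵐ x ∂P, play G s' (g x) h i = play G s (g x) h i)) ∧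
    -- the linear systems can be solved in every slot along the filter recursion
    (∃ R : FilterRun G, IsFilterRun G R) ∧
    -- and the outcome describes the posterior means and the equilibrium
    (∀ (s : Profile G) (R : FilterRun G), IsBNE G P g ω s → IsFilterRun G R →
      ∀ h < G.H, ∀ i,
        (∀ᵐ x ∂P, posteriorMean G P g s h i x = R.T h i *ᵥ augment G (g x)) ∧
        (∀ a b, ∫ x, (augment G (g x) a - posteriorMean G P g s h i x a) *
          (augment G (g x) b - posteriorMean G P g s h i x b) ∂P = R.M h i a b) ∧
        (∀ᵐ x ∂P, s h i (infoAt G s (g x) h i)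
          = R.v h i ⬝ᵥ posteriorMean G P g s h i x + R.r h i)) := by
  have hG : IsGaussianModel G P g ω :=
    ⟨hγ, hκ, hα, hgBar, hgm, hg, hmean, hcov, hvar, hωint, hωmean, hind⟩
  refine ⟨⟨_, isBNE_filterProfile hG (chosenRun_isFilterRun hG)⟩, ?_,
    ⟨_, chosenRun_isFilterRun hG⟩, ?_⟩
  · intro s s' hs hs' h hh i
    refine ⟨hs.strategy_ae_eq hG hs' hh i, ?_⟩
    filter_upwards [hs.play_ae_eq hG hs' hh] with x hx
    rw [hx]
  · intro s R hs hR h hh i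
    exact ⟨hs.posteriorMean_ae_eq hG hR hh i, hs.integral_posterior_error hG hR hh i,
      hs.strategy_eq hG hR hh i⟩
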